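/- **Theorem 3.12** (structure theorem for the dual of $(\mathcal O^m_{n,\omega,p}(\mathbb R^N), r_{m,n,p})$). *Setting.* Functions are complex valued, $\mathbb N=\{1,2,\dots\}$, $\mathbb N_0=\mathbb N\cup\{0\}$. A non-quasianalytic weight function is a continuous increasing $\omega:[0,\infty)\to[0,\infty)$ such that: $\omega(2t)\le K(1+\omega(t))$ for all $t\ge 0$ and some $K\ge 1$; $\int_1^\infty \frac{\omega(t)}{1+t^2}\,dt<\infty$; $\omega(t)\ge a+b\log(1+t)$ for all $t\ge 0$ and some $a\in\mathbb R$, $b>0$; and $t\mapsto\omega(e^t)$ is convex on $\mathbb R$. Put $\omega(x)=\omega(|x|)$ for $x\in\mathbb R^N$ and $\varphi^*_\omega(s)=\sup_{t\ge 0}\{st-\omega(e^t)\}\in(-\infty,+\infty]$ for $s\ge0$, with $e^{+\infty}=\infty$, $e^{-\infty}=0$, $0\cdot\infty=0$. The space $\mathcal D_\omega(\mathbb R^N)$ consists of all compactly supported $f\in C^\infty(\mathbb R^N)$ such that $p_{K,m}(f)=\sup_{x\in K}\sup_{\alpha\in\mathbb N_0^N}|\partial^\alpha f(x)|\exp(-m\varphi^*_\omega(|\alpha|/m))<\infty$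 for all compact $K\subset\mathbb R^N$ and all $m\in\mathbb N$. It carries the locally convex inductive limit topology of its subspaces $\mathcal D_\omega(K)=\{f:\operatorname{supp} f\subseteq K\}$, $K$ compact, each topologized by the norms $p_{K,m}$, $m\in\mathbb N$; $\mathcal D'_\omega(\mathbb R^N)$ is its strong dual. For $m\in\mathbb N$, $n\in\mathbb Z$, $1\le p<\infty$, let $\mathcal O^m_{n,\omega,p}(\mathbb R^N)$ be the space of all $f\in C^\infty(\mathbb R^N)$ with $$r_{m,n,p}(f)=\Big(\sum_{\alpha\in\mathbb N_0^N}\|e^{-n\omega}\partial^\alpha f\|_p^p\,\exp\big(-mp\,\varphi^*_\omega(|\alpha|/m)\big)\Big)^{1/p}<\infty ,$$ normed by $r_{m,n,p}$. For $1\le q\le\infty$ let $(\oplus L^{q}(\mathbb R^N,e^{n\omega(x)}dx))_{\omega,m,q}$ be the set of all families $(f_\alpha)_{\alpha\in\mathbb N_0^N}$ of Lebesgue measurable functions on $\mathbb R^N$ with $\sum_\alpha\|e^{n\omega}f_\alpha\|_q^q\exp(qm\varphi^*_\omega(|\alpha|/m))<\infty$ if $q<\infty$, and $\sup_\alpha\|e^{n\omega}f_\alpha\|_\infty\exp(m\varphi^*_\omega(|\alpha|/m))<\infty$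 if $q=\infty$. *Statement.* Let $\omega$ be a non-quasianalytic weight function, $T\in\mathcal D'_\omega(\mathbb R^N)$, $m\in\mathbb N$, $n\in\mathbb Z$, $1\le p<\infty$ and $\frac1p+\frac1{p'}=1$. Then $T\in(\mathcal O^m_{n,\omega,p}(\mathbb R^N),r_{m,n,p})'$, that is, $\mathcal D_\omega(\mathbb R^N)\subseteq\mathcal O^m_{n,\omega,p}(\mathbb R^N)$ and $T$ extends to a continuous linear functional on $\mathcal O^m_{n,\omega,p}(\mathbb R^N)$, if and only if there is $(f_\alpha)_{\alpha}\in(\oplus L^{p'}(\mathbb R^N,e^{n\omega(x)}dx))_{\omega,m,p'}$ with $$T=\sum_{\alpha\in\mathbb N_0^N}\partial^\alpha f_\alpha ,$$ where each $\partial^\alpha f_\alpha:\varphi\mapsto(-1)^{|\alpha|}\int_{\mathbb R^N} f_\alpha\,\partial^\alpha\varphi\,dx$ is an element of $\mathcal D'_\omega(\mathbb R^N)$ and the series converges unconditionally in $\mathcal D'_\omega(\mathbb R^N)$. Moreover, let $F$ be a linear functional on $\mathcal O^m_{n,\omega,p}(\mathbb R^N)$ that extends $T$. Then $F$ is continuous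 if and only if there is $(f_\alpha)_\alpha$ in the same weighted space with $T=\sum_\alpha\partial^\alpha f_\alpha$ as above and $$F(g)=\sum_{\alpha\in\mathbb N_0^N}(-1)^{|\alpha|}\int_{\mathbb R^N}f_\alpha\,\partial^\alpha g\,dx\quad\text{for all } g\in\mathcal O^m_{n,\omega,p}(\mathbb R^N),$$ the series converging absolutely. -/

import Mathlib

open MeasureTheory Set
open scoped ENNReal NNReal

noncomputable section

namespace BeurlingUltra

/-- A non-quasianalytic weight function. -/
structure WeightFunction where
  toFun : ℝ≥0 → ℝ≥0
  continuous' : Continuous toFun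
  monotone' : Monotone toFun
  doubling' : ∃ K : ℝ≥0, 1 ≤ K ∧ ∀ t, toFun (2 * t) ≤ K * (1 + toFun t)
  integrable' : IntegrableOn (fun t : ℝ => (toFun t.toNNReal : ℝ) / (1 + t ^ 2)) (Ioi 1) volume
  log_bound' : ∃ a b : ℝ, 0 < b ∧ ∀ t : ℝ≥0, a + b * Real.log (1 + (t : ℝ)) ≤ (toFun t : ℝ)
  convex' : ConvexOn ℝ univ (fun t : ℝ => (toFun (Real.exp t).toNNReal : ℝ))

/-- The Euclidean space `ℝ^N`. -/
abbrev Eucl (N : ℕ) : Type := EuclideanSpace ℝ (Fin N)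

/-- Multi-indices in `ℕ₀^N`. -/
abbrev MultiIndex (N : ℕ) : Type := Fin N → ℕ

/-- The length `|α|`. -/
def MultiIndex.len {N : ℕ} (α : MultiIndex N) : ℕ := ∑ i, α i

/-- The radial extension `x ↦ ω(|x|)` of the weight to `ℝ^N`, `|x|` the Euclidean norm. -/
def WeightFunction.radial (ω : WeightFunction) {N : ℕ} (x : Eucl N) : ℝ := (ω.toFun ‖x‖₊ : ℝ)

/-- The Young conjugate `φ*(s) = sup_{t ≥ 0} (s t - ω(exp t))`. It takes the value `+∞` for large
`s` exactly when `ω` grows only logarithmically. -/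
def WeightFunction.youngConj (ω : WeightFunction) (s : ℝ) : EReal :=
  ⨆ t : ℝ≥0, ((s * t - (ω.toFun (Real.exp t).toNNReal : ℝ) : ℝ) : EReal)

/-- The number `exp (m φ*(|α|/m))` in `(0, ∞]`. Its inverse is `exp (-m φ*(|α|/m))` in `[0, ∞)`,
with the conventions `exp (+∞) = ∞` and `exp (-∞) = 0`. -/
def WeightFunction.expYoung (ω : WeightFunction) (m : ℕ) {N : ℕ} (α : MultiIndex N) : ℝ≥0∞ :=
  EReal.exp ((m : EReal) * ω.youngConj ((α.len : ℝ) / (m : ℝ)))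

/-- The complex vector space `C^∞(ℝ^N)`. -/
def Smooth (N : ℕ) : Submodule ℂ (Eucl N → ℂ) where
  carrier := {f | ContDiff ℝ (⊤ : ℕ∞) f}
  add_mem' {f g} hf hg := by
    have hf' : ContDiff ℝ (⊤ : ℕ∞) f := hf
    have hg' : ContDiff ℝ (⊤ : ℕ∞) g := hg
    exact hf'.add hg'
  zero_mem' := by
    have h : ContDiff ℝ (⊤ : ℕ∞) (0 : Eucl N → ℂ) := contDiff_const
    exact h
  smul_mem' c f hf := by
    have hf' : ContDiff ℝ (⊤ : ℕ∞) f := hf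
    have h : ContDiff ℝ (⊤ : ℕ∞) (c • f) := contDiff_const.smul hf'
    exact h

lemma Smooth.contDiff {N : ℕ} (f : Smooth N) : ContDiff ℝ (⊤ : ℕ∞) f.1 := f.2

/-- The partial derivative `∂_i` on `C^∞(ℝ^N)`. -/
def pderiv {N : ℕ} (i : Fin N) : Module.End ℂ (Smooth N) where
  toFun f := ⟨fun x => fderiv ℝ f.1 x (EuclideanSpace.single i 1),
    ((Smooth.contDiff f).fderiv_right (m := (⊤ : ℕ∞)) (by simp)).clm_apply contDiff_const⟩
  map_add' f g := by
    ext x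
    have hf : Differentiable ℝ f.1 := (Smooth.contDiff f).differentiable (by simp)
    have hg : Differentiable ℝ g.1 := (Smooth.contDiff g).differentiable (by simp)
    simp [fderiv_add (hf x) (hg x)]
  map_smul' c f := by
    ext x
    have hf : Differentiable ℝ f.1 := (Smooth.contDiff f).differentiable (by simp)
    simp [fderiv_const_smul (hf x) c]

/-- The partial derivative `∂^α = ∂_0^{α_0} ⋯ ∂_{N-1}^{α_{N-1}}` on `C^∞(ℝ^N)`. -/
def mderiv {N : ℕ} (α : MultiIndex N) : Module.End ℂ (Smooth N) :=
  (List.ofFn fun i => pderiv i ^ α i).prod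

/-! ### Test functions and ultradistributions of Beurling type -/

/-- `p_{K,m}(f) = sup_{x ∈ K} sup_α |∂^α f(x)| exp (-m φ*(|α|/m))`. -/
def pSeminorm (ω : WeightFunction) {N : ℕ} (K : Set (Eucl N)) (m : ℕ) (f : Smooth N) : ℝ≥0∞ :=
  ⨆ x ∈ K, ⨆ α : MultiIndex N, ‖(mderiv α f).1 x‖ₑ * (ω.expYoung m α)⁻¹

lemma expYoung_ne_zero (ω : WeightFunction) {m : ℕ} {N : ℕ} (α : MultiIndex N) :
    ω.expYoung m α ≠ 0 := by
  have h : ((-(ω.toFun 1 : ℝ) : ℝ) : EReal) ≤ ω.youngConj ((α.len : ℝ) / (m : ℝ)) := by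
    refine le_trans ?_ (le_iSup _ (0 : ℝ≥0))
    simp
  have hb : (⊥ : EReal) < ω.youngConj ((α.len : ℝ) / (m : ℝ)) :=
    lt_of_lt_of_le (EReal.bot_lt_coe _) h
  unfold WeightFunction.expYoung
  rw [Ne, EReal.exp_eq_zero_iff]
  intro h0
  rcases Nat.eq_zero_or_pos m with rfl | hm
  · simp at h0
  · have hm' : (0 : EReal) ≤ (m : EReal) := by exact_mod_cast hm.le
    have := mul_le_mul_of_nonneg_left h hm'
    rw [h0, le_bot_iff] at this
    have h2 : ((m : ℝ) * (-(ω.toFun 1 : ℝ)) : ℝ) = (⊥ : EReal) := by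
      rw [← this]; push_cast; rfl
    exact EReal.coe_ne_bot _ h2

lemma inv_expYoung_ne_top (ω : WeightFunction) {m : ℕ} {N : ℕ} (α : MultiIndex N) :
    (ω.expYoung m α)⁻¹ ≠ ∞ := ENNReal.inv_ne_top.2 (expYoung_ne_zero ω α)

lemma pSeminorm_add_le (ω : WeightFunction) {N : ℕ} (K : Set (Eucl N)) (m : ℕ) (f g : Smooth N) :
    pSeminorm ω K m (f + g) ≤ pSeminorm ω K m f + pSeminorm ω K m g := by
  refine iSup₂_le fun x hx => iSup_le fun α => ?_
  have h1 : ‖(mderiv α (f + g)).1 x‖ₑ ≤ ‖(mderiv α f).1 x‖ₑ + ‖(mderiv α g).1 x‖ₑ := by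
    rw [map_add]; exact enorm_add_le _ _
  refine (mul_le_mul_left h1 _).trans ?_
  rw [add_mul]
  gcongr
  · exact le_trans (le_iSup (fun α => ‖(mderiv α f).1 x‖ₑ * (ω.expYoung m α)⁻¹) α)
      (le_iSup₂ (f := fun x (_ : x ∈ K) =>
        ⨆ α : MultiIndex N, ‖(mderiv α f).1 x‖ₑ * (ω.expYoung m α)⁻¹) x hx)
  · exact le_trans (le_iSup (fun α => ‖(mderiv α g).1 x‖ₑ * (ω.expYoung m α)⁻¹) α)
      (le_iSup₂ (f := fun x (_ : x ∈ K) =>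
        ⨆ α : MultiIndex N, ‖(mderiv α g).1 x‖ₑ * (ω.expYoung m α)⁻¹) x hx)

lemma pSeminorm_smul (ω : WeightFunction) {N : ℕ} (K : Set (Eucl N)) (m : ℕ) (c : ℂ)
    (f : Smooth N) : pSeminorm ω K m (c • f) = ‖c‖ₑ * pSeminorm ω K m f := by
  simp only [pSeminorm, ENNReal.mul_iSup, map_smul, ← mul_assoc]
  refine iSup_congr fun x => iSup_congr fun _ => iSup_congr fun α => ?_
  congr 1
  exact enorm_smul c ((mderiv α f).1 x)

/-- The subspace `𝒟_ω(ℝ^N)` of `C^∞(ℝ^N)`. -/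
def testSubmodule (ω : WeightFunction) (N : ℕ) : Submodule ℂ (Smooth N) where
  carrier := {f | HasCompactSupport f.1 ∧
    ∀ K : Set (Eucl N), IsCompact K → ∀ m : ℕ, 1 ≤ m → pSeminorm ω K m f < ∞}
  add_mem' := by
    rintro f g ⟨hf, hf'⟩ ⟨hg, hg'⟩
    exact ⟨HasCompactSupport.add hf hg, fun K hK m hm => lt_of_le_of_lt
      (pSeminorm_add_le ω K m f g) (ENNReal.add_lt_top.2 ⟨hf' K hK m hm, hg' K hK m hm⟩)⟩
  zero_mem' := by
    refine ⟨HasCompactSupport.zero, fun K _ m _ => ?_⟩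
    have : pSeminorm ω K m (0 : Smooth N) = 0 := by
      simpa using pSeminorm_smul ω K m 0 (0 : Smooth N)
    simp [this]
  smul_mem' := by
    rintro c f ⟨hf, hf'⟩
    refine ⟨?_, fun K hK m hm => ?_⟩
    · exact HasCompactSupport.smul_left (f := fun _ => c) hf
    · rw [pSeminorm_smul]
      exact ENNReal.mul_lt_top enorm_lt_top (hf' K hK m hm)

/-- The space `𝒟_ω(ℝ^N)` of test functions of Beurling type. -/
def TestFun (ω : WeightFunction) (N : ℕ) : Type := ↥(testSubmodule ω N)

namespace TestFun

variable (ω : WeightFunction) (N : ℕ)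

instance : AddCommGroup (TestFun ω N) := inferInstanceAs (AddCommGroup ↥(testSubmodule ω N))

instance : Module ℂ (TestFun ω N) := inferInstanceAs (Module ℂ ↥(testSubmodule ω N))

variable {ω N}

/-- The inclusion `𝒟_ω(ℝ^N) ⊆ C^∞(ℝ^N)`. -/
def toSmooth : TestFun ω N →ₗ[ℂ] Smooth N := (testSubmodule ω N).subtype

variable (ω N)

/-- The seminorms on `𝒟_ω(ℝ^N)` whose restriction to each Fréchet space
`𝒟_ω(K) = {φ : supp φ ⊆ K}`, topologized by the increasing sequence of norms `p_{K,m}`, `m ≥ 1`,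
is continuous. -/
def ContSeminorm : Type :=
  {q : Seminorm ℂ (TestFun ω N) // ∀ K : Set (Eucl N), IsCompact K →
    ∃ m : ℕ, 1 ≤ m ∧ ∃ C : ℝ≥0, ∀ φ : TestFun ω N, tsupport (toSmooth φ).1 ⊆ K →
      ENNReal.ofReal (q φ) ≤ C * pSeminorm ω K m (toSmooth φ)}

instance : Nonempty (ContSeminorm ω N) :=
  ⟨⟨0, fun _ _ => ⟨1, le_rfl, 0, fun φ _ => by simp⟩⟩⟩

/-- The family of all those seminorms. -/
def seminormFamily : SeminormFamily ℂ (TestFun ω N) (ContSeminorm ω N) := fun q => q.1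

/-- The locally convex inductive limit topology of the spaces `𝒟_ω(K)`, `K ⊆ ℝ^N` compact: the
finest locally convex topology for which all inclusions of the `𝒟_ω(K)` are continuous. It is
generated by all seminorms with continuous restrictions to every `𝒟_ω(K)`. -/
instance : TopologicalSpace (TestFun ω N) := (seminormFamily ω N).moduleFilterBasis.topology

theorem withSeminorms : WithSeminorms (seminormFamily ω N) := ⟨rfl⟩

instance : IsTopologicalAddGroup (TestFun ω N) := (withSeminorms ω N).topologicalAddGroup

instance : ContinuousSMul ℂ (TestFun ω N) := (withSeminorms ω N).continuousSMul

end TestFun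

/-- The space `𝒟'_ω(ℝ^N)` of ultradistributions of Beurling type, with the strong topology
(uniform convergence on the bounded subsets of `𝒟_ω(ℝ^N)`). -/
abbrev UltraDist (ω : WeightFunction) (N : ℕ) : Type := TestFun ω N →L[ℂ] ℂ

/-- `⟨∂^α f, φ⟩ = (-1)^|α| ∫ f ∂^α φ`. -/
def derivPairing {N : ℕ} (α : MultiIndex N) (f : Eucl N → ℂ) (φ : Smooth N) : ℂ :=
  (-1) ^ α.len * ∫ x, f x * (mderiv α φ).1 x

/-- `T = ∑_α ∂^α f_α` in `𝒟'_ω(ℝ^N)`: each `∂^α f_α` is an ultradistribution, and their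
series converges (unconditionally, for the strong topology) to `T`. -/
def IsSumOfDerivs {ω : WeightFunction} {N : ℕ} (T : UltraDist ω N)
    (f : MultiIndex N → Eucl N → ℂ) : Prop :=
  ∃ U : MultiIndex N → UltraDist ω N,
    (∀ α φ, U α φ = derivPairing α (f α) φ.toSmooth) ∧ HasSum U T

/-! ### The weighted spaces -/

/-- The `ℓ^p`-norm of a family in `[0, ∞]`. -/
def ellNorm {ι : Type*} (p : ℝ≥0∞) (a : ι → ℝ≥0∞) : ℝ≥0∞ :=
  if p = ∞ then ⨆ i, a i else (∑' i, a i ^ p.toReal) ^ (1 / p.toReal)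

lemma ellNorm_mono {ι : Type*} {p : ℝ≥0∞} {a b : ι → ℝ≥0∞} (h : ∀ i, a i ≤ b i) :
    ellNorm p a ≤ ellNorm p b := by
  unfold ellNorm
  split_ifs
  · exact iSup_mono h
  · exact ENNReal.rpow_le_rpow (ENNReal.tsum_le_tsum fun i =>
      ENNReal.rpow_le_rpow (h i) ENNReal.toReal_nonneg) (by positivity)

lemma ellNorm_add_le {ι : Type*} {p : ℝ≥0∞} (hp : 1 ≤ p) (a b : ι → ℝ≥0∞) :
    ellNorm p (fun i => a i + b i) ≤ ellNorm p a + ellNorm p b := by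
  unfold ellNorm
  split_ifs with h
  · exact iSup_le fun i => add_le_add (le_iSup a i) (le_iSup b i)
  · have h1 : 1 ≤ p.toReal := by
      simpa using (ENNReal.toReal_le_toReal ENNReal.one_ne_top h).2 hp
    let _ : MeasurableSpace ι := ⊤
    have := ENNReal.lintegral_Lp_add_le (μ := Measure.count) (f := a) (g := b)
      (measurable_from_top.aemeasurable) (measurable_from_top.aemeasurable) h1
    simpa only [lintegral_count, Pi.add_apply] using this

lemma ellNorm_const_mul {ι : Type*} {p : ℝ≥0∞} (hp : 1 ≤ p) (c : ℝ≥0∞) (a : ι → ℝ≥0∞) :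
    ellNorm p (fun i => c * a i) = c * ellNorm p a := by
  unfold ellNorm
  split_ifs with h
  · rw [ENNReal.mul_iSup]
  · have h1 : 1 ≤ p.toReal := by
      simpa using (ENNReal.toReal_le_toReal ENNReal.one_ne_top h).2 hp
    have h0 : 0 ≤ p.toReal := by linarith
    simp_rw [ENNReal.mul_rpow_of_nonneg _ _ h0]
    rw [ENNReal.tsum_mul_left, ENNReal.mul_rpow_of_nonneg _ _ (by positivity),
      ← ENNReal.rpow_mul, mul_one_div_cancel (by linarith), ENNReal.rpow_one]

lemma le_ellNorm {ι : Type*} {p : ℝ≥0∞} (hp : 1 ≤ p) (a : ι → ℝ≥0∞) (i : ι) :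
    a i ≤ ellNorm p a := by
  unfold ellNorm
  split_ifs with h
  · exact le_iSup a i
  · have h1 : 1 ≤ p.toReal := by
      simpa using (ENNReal.toReal_le_toReal ENNReal.one_ne_top h).2 hp
    calc a i = (a i ^ p.toReal) ^ (1 / p.toReal) := by
          rw [← ENNReal.rpow_mul, mul_one_div_cancel (by linarith), ENNReal.rpow_one]
      _ ≤ _ := ENNReal.rpow_le_rpow (ENNReal.le_tsum i) (by positivity)

/-- `‖exp(nω) f‖_p`, the norm of `L^p(ℝ^N, exp(nω(x)) dx)`. -/
def wNorm (ω : WeightFunction) {N : ℕ} (n : ℤ) (p : ℝ≥0∞) (f : Eucl N → ℂ) : ℝ≥0∞ :=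
  eLpNorm (fun x => (Real.exp (n * ω.radial x) : ℂ) * f x) p volume

lemma continuous_expWeight (ω : WeightFunction) {N : ℕ} (n : ℤ) :
    Continuous (fun x : Eucl N => (Real.exp (n * ω.radial x) : ℂ)) := by
  have := ω.continuous'
  unfold WeightFunction.radial
  fun_prop

lemma wNorm_add_le (ω : WeightFunction) {N : ℕ} (n : ℤ) {p : ℝ≥0∞} (hp : 1 ≤ p) (f g : Smooth N) :
    wNorm ω n p (f + g).1 ≤ wNorm ω n p f.1 + wNorm ω n p g.1 := by
  have hm (f : Smooth N) : AEStronglyMeasurable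
      (fun x => (Real.exp (n * ω.radial x) : ℂ) * f.1 x) volume :=
    ((continuous_expWeight ω n).mul (Smooth.contDiff f).continuous).aestronglyMeasurable
  refine le_trans (le_of_eq ?_) (eLpNorm_add_le (hm f) (hm g) hp)
  unfold wNorm
  congr 1
  ext x
  simp [mul_add]

lemma wNorm_smul (ω : WeightFunction) {N : ℕ} (n : ℤ) (p : ℝ≥0∞) (c : ℂ) (f : Smooth N) :
    wNorm ω n p (c • f).1 = ‖c‖ₑ * wNorm ω n p f.1 := by
  unfold wNorm
  rw [← eLpNorm_const_smul]
  congr 1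
  ext x
  simp [mul_left_comm]

/-- `r_{m,n,p}(f) = (∑_α ‖exp(-nω) ∂^α f‖_p^p exp (-m p φ*(|α|/m)))^{1/p}`. -/
def rNorm (ω : WeightFunction) {N : ℕ} (m : ℕ) (n : ℤ) (p : ℝ≥0∞) (f : Smooth N) : ℝ≥0∞ :=
  ellNorm p fun α : MultiIndex N => wNorm ω (-n) p (mderiv α f).1 * (ω.expYoung m α)⁻¹

lemma rNorm_add_le (ω : WeightFunction) {N : ℕ} (m : ℕ) (n : ℤ) {p : ℝ≥0∞} (hp : 1 ≤ p)
    (f g : Smooth N) : rNorm ω m n p (f + g) ≤ rNorm ω m n p f + rNorm ω m n p g := by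
  refine le_trans (ellNorm_mono fun α => ?_) (ellNorm_add_le hp _ _)
  rw [← add_mul, map_add]
  exact mul_le_mul_left (wNorm_add_le ω (-n) hp _ _) _

lemma rNorm_smul (ω : WeightFunction) {N : ℕ} (m : ℕ) (n : ℤ) {p : ℝ≥0∞} (hp : 1 ≤ p) (c : ℂ)
    (f : Smooth N) : rNorm ω m n p (c • f) = ‖c‖ₑ * rNorm ω m n p f := by
  unfold rNorm
  rw [← ellNorm_const_mul hp]
  simp_rw [map_smul, wNorm_smul, mul_assoc]

lemma rNorm_zero (ω : WeightFunction) {N : ℕ} (m : ℕ) (n : ℤ) {p : ℝ≥0∞} (hp : 1 ≤ p) :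
    rNorm ω m n p (0 : Smooth N) = 0 := by
  simpa using rNorm_smul ω m n hp 0 (0 : Smooth N)

lemma eq_zero_of_rNorm_eq_zero (ω : WeightFunction) {N : ℕ} (m : ℕ) (n : ℤ) {p : ℝ≥0∞}
    (hp : 1 ≤ p) (f : Smooth N) (h : rNorm ω m n p f = 0) : f = 0 := by
  have h0 := le_ellNorm hp (fun α : MultiIndex N =>
    wNorm ω (-n) p (mderiv α f).1 * (ω.expYoung m α)⁻¹) 0
  have hfin : ω.expYoung m (0 : MultiIndex N) ≠ ∞ := by
    have hy : ω.youngConj 0 ≤ 0 := iSup_le fun t => by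
      norm_cast
      simp
    have hle : (m : EReal) * ω.youngConj 0 ≤ (m : EReal) * 0 :=
      mul_le_mul_of_nonneg_left hy (by positivity)
    have : ω.expYoung m (0 : MultiIndex N) ≤ 1 := by
      unfold WeightFunction.expYoung
      rw [EReal.exp_le_one_iff]
      simpa [MultiIndex.len] using hle
    exact ne_top_of_le_ne_top ENNReal.one_ne_top this
  have h1 : wNorm ω (-n) p f.1 = 0 := by
    have h2 : wNorm ω (-n) p (mderiv (0 : MultiIndex N) f).1 *
        (ω.expYoung m (0 : MultiIndex N))⁻¹ = 0 := le_antisymm (h0.trans h.le) bot_le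
    have h3 : mderiv (0 : MultiIndex N) f = f := by simp [mderiv]
    rw [h3] at h2
    exact (mul_eq_zero.1 h2).resolve_right (ENNReal.inv_ne_zero.2 hfin)
  have hc : Continuous (fun x => (Real.exp ((-n : ℤ) * ω.radial x) : ℂ) * f.1 x) :=
    (continuous_expWeight ω (-n)).mul (Smooth.contDiff f).continuous
  have hp0 : p ≠ 0 := (lt_of_lt_of_le zero_lt_one hp).ne'
  unfold wNorm at h1
  rw [eLpNorm_eq_zero_iff hc.aestronglyMeasurable hp0] at h1
  have h4 := (hc.ae_eq_iff_eq volume continuous_zero).1 h1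
  ext x
  have h5 := congrFun h4 x
  simpa [Complex.ofReal_ne_zero] using h5

/-- The subspace of `C^∞(ℝ^N)` on which `r_{m,n,p}` is finite. -/
def oSubmodule (ω : WeightFunction) (N m : ℕ) (n : ℤ) (p : ℝ≥0∞) (hp : 1 ≤ p) :
    Submodule ℂ (Smooth N) where
  carrier := {f | rNorm ω m n p f < ∞}
  add_mem' hf hg := lt_of_le_of_lt (rNorm_add_le ω m n hp _ _) (ENNReal.add_lt_top.2 ⟨hf, hg⟩)
  zero_mem' := by simp [rNorm_zero ω m n hp]
  smul_mem' c f hf := by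
    simp only [mem_ofPred_eq, rNorm_smul ω m n hp] at hf ⊢
    exact ENNReal.mul_lt_top enorm_lt_top hf

/-- The space `𝒪^m_{n,ω,p}(ℝ^N)`, normed by `r_{m,n,p}`. -/
def OSpace (ω : WeightFunction) (N m : ℕ) (n : ℤ) (p : ℝ≥0∞) [hp : Fact (1 ≤ p)] : Type := ↥(oSubmodule ω N m n p hp.out)

namespace OSpace

variable (ω : WeightFunction) (N m : ℕ) (n : ℤ) (p : ℝ≥0∞) [hp : Fact (1 ≤ p)]

instance : AddCommGroup (OSpace ω N m n p) :=
  inferInstanceAs (AddCommGroup ↥(oSubmodule ω N m n p hp.out))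

instance : Module ℂ (OSpace ω N m n p) :=
  inferInstanceAs (Module ℂ ↥(oSubmodule ω N m n p hp.out))

variable {ω N m n p}

/-- The inclusion `𝒪^m_{n,ω,p}(ℝ^N) ⊆ C^∞(ℝ^N)`. -/
def toSmooth : OSpace ω N m n p →ₗ[ℂ] Smooth N := (oSubmodule ω N m n p hp.out).subtype

lemma rNorm_lt_top (f : OSpace ω N m n p) : rNorm ω m n p f.toSmooth < ∞ := f.2

variable (ω N m n p)

instance : Norm (OSpace ω N m n p) := ⟨fun f => (rNorm ω m n p f.toSmooth).toReal⟩

lemma norm_def (f : OSpace ω N m n p) : ‖f‖ = (rNorm ω m n p f.toSmooth).toReal := rfl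

lemma normCore : NormedSpace.Core ℂ (OSpace ω N m n p) where
  norm_nonneg _ := ENNReal.toReal_nonneg
  norm_smul c f := by
    rw [norm_def, norm_def, map_smul, rNorm_smul ω m n hp.out, ENNReal.toReal_mul, toReal_enorm]
  norm_triangle f g := by
    rw [norm_def, norm_def, norm_def, map_add,
      ← ENNReal.toReal_add f.rNorm_lt_top.ne g.rNorm_lt_top.ne]
    exact ENNReal.toReal_mono (ENNReal.add_lt_top.2 ⟨f.rNorm_lt_top, g.rNorm_lt_top⟩).ne
      (rNorm_add_le ω m n hp.out _ _)
  norm_eq_zero_iff f := by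
    rw [norm_def, ENNReal.toReal_eq_zero_iff, or_iff_left f.rNorm_lt_top.ne]
    constructor
    · intro h
      exact Subtype.ext (eq_zero_of_rNorm_eq_zero ω m n hp.out _ h)
    · rintro rfl
      rw [map_zero, rNorm_zero ω m n hp.out]

instance : NormedAddCommGroup (OSpace ω N m n p) := NormedAddCommGroup.ofCore (normCore ω N m n p)

instance : NormedSpace ℂ (OSpace ω N m n p) := NormedSpace.ofCore (normCore ω N m n p)

variable {ω N m n p}

/-- The linear functional `F` on `𝒪^m_{n,ω,p}(ℝ^N)` extends the ultradistribution `T`: every test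
function `φ` belongs to `𝒪^m_{n,ω,p}(ℝ^N)`, and `F φ = T φ`. -/
def Extends (F : OSpace ω N m n p →ₗ[ℂ] ℂ) (T : UltraDist ω N) : Prop :=
  ∀ φ : TestFun ω N, ∃ g : OSpace ω N m n p, g.toSmooth = φ.toSmooth ∧ F g = T φ

variable (m n p) in
/-- The ultradistribution `T` belongs to the dual of `𝒪^m_{n,ω,p}(ℝ^N)`: it extends to a
continuous linear functional on that space. -/
def MemDual (T : UltraDist ω N) : Prop :=
  ∃ F : StrongDual ℂ (OSpace ω N m n p), Extends (F : OSpace ω N m n p →ₗ[ℂ] ℂ) T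

end OSpace

/-- The sequence `(f_α)` belongs to `(⊕ L^p(ℝ^N, exp(nω(x)) dx))_{ω,m,p}`, `1 ≤ p ≤ ∞`: the `f_α`
are Lebesgue measurable, and the `ℓ^p`-norm of `‖exp(nω) f_α‖_p exp (m φ*(|α|/m))` is finite. -/
def MemWeightedSum (ω : WeightFunction) {N : ℕ} (m : ℕ) (n : ℤ) (p : ℝ≥0∞)
    (f : MultiIndex N → Eucl N → ℂ) : Prop :=
  (∀ α, AEStronglyMeasurable (f α) volume) ∧
    ellNorm p (fun α => wNorm ω n p (f α) * ω.expYoung m α) < ∞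

end BeurlingUltra

end

/-! The weighted jet `g ↦ (exp(-m φ*(|α|/m)) e^{-nω} ∂^α g)_α` embeds the normed space isometrically
into `L^p` of counting measure times Lebesgue measure (`eLpNorm_weightedJet`). A continuous
functional thus extends by Hahn–Banach to that `L^p`, where it is integration against some `G ∈
L^{p'}` (`LpDual.exists_memLp_of_le_eLpNorm`). Moving the weights and the signs from the jet onto
the slices of `G` produces the `f_α` (`exists_memWeightedSum_of_continuous`). Conversely, Hölder in
`x` and then in `α` makes the series of pairings converge absolutely to a continuous functional
(`exists_strongDual_of_memWeightedSum`).

What remains is topological: test functions embed continuously, and the series converges in the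
strong dual, not just pointwise. Both rest on `exists_expYoung_le`: the doubling property of `ω`
lets one pass from `m` to a larger `k` and gain a factor `e^{-|α|}`, which is summable over
multi-indices. The gain turns the suprema over `α` in the seminorms of test functions into `ℓ^p`
sums, and makes the series of functionals converge in operator norm at level `k`, hence strongly
after composition with the embedding (`isSumOfDerivs_of_hasSum`). Density of the test functions is
never needed. -/

noncomputable section

/-! ### The dual of `L^p` for `1 ≤ p < ∞`, complex scalars, σ-finite measures. -/

namespace LpDual

open Filter Topology

variable {X : Type*} [MeasurableSpace X] {μ : Measure X} {p q : ℝ≥0∞}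

/-- The complex measure `A ↦ Φ (1_A)` of a continuous linear functional `Φ` on `L^p` of a finite
measure. -/
def toComplexMeasure [IsFiniteMeasure μ] [Fact (1 ≤ p)] (hp : p ≠ ∞)
    (Φ : Lp ℂ p μ →L[ℂ] ℂ) : ComplexMeasure X := by
  classical
  exact
  { measureOf' := fun A =>
      if hA : MeasurableSet A then Φ (indicatorConstLp p hA (measure_ne_top μ A) 1) else 0
    empty' := by simp
    not_measurable' := fun A hA => by simp [hA]
    m_iUnion' := fun A hA hd => by
      simp only [hA, MeasurableSet.iUnion hA, dif_pos]
      have hfin (s : Finset ℕ) : ∑ i ∈ s, indicatorConstLp p (hA i) (measure_ne_top μ (A i)) (1 : ℂ)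
          = indicatorConstLp p (s.measurableSet_biUnion fun i _ => hA i)
            (measure_ne_top μ (⋃ i ∈ s, A i)) 1 := by
        induction s using Finset.induction_on with
        | empty => simp
        | insert a s ha ih =>
          rw [Finset.sum_insert ha, ih, ← indicatorConstLp_disjoint_union]
          · congr 1
            simp
          · rw [disjoint_iUnion₂_right]
            intro i hi
            exact hd (fun h => ha (h ▸ hi))
      -- Countable additivity: a finite partial union differs from the full union by the remaining
      -- sets, whose total measure is the tail of a convergent series. Small measure means small
      -- `L^p` norm because `p < ∞`.
      have h0 : HasSum (fun i => indicatorConstLp p (hA i) (measure_ne_top μ (A i)) (1 : ℂ))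
          (indicatorConstLp p (MeasurableSet.iUnion hA) (measure_ne_top μ _) 1) := by
        unfold HasSum
        simp only [hfin]
        refine tendsto_indicatorConstLp_set hp ?_
        have hsum : ∑' i, μ (A i) ≠ ∞ := by
          rw [← measure_iUnion hd hA]
          exact measure_ne_top _ _
        refine tendsto_of_tendsto_of_tendsto_of_le_of_le tendsto_const_nhds
          (ENNReal.tendsto_tsum_compl_atTop_zero hsum) (fun s => zero_le) fun s => ?_
        have : symmDiff (⋃ i ∈ s, A i) (⋃ i, A i) ⊆ ⋃ b : {x // x ∉ s}, A b := by
          rintro x (⟨h1, h2⟩ | ⟨h1, h2⟩)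
          · simp only [mem_iUnion, exists_prop] at h1 h2
            obtain ⟨i, -, hi⟩ := h1
            exact absurd ⟨i, hi⟩ h2
          · simp only [mem_iUnion, exists_prop, not_exists, not_and] at h1 h2
            obtain ⟨i, hi⟩ := h1
            exact mem_iUnion.2 ⟨⟨i, fun h => h2 i h hi⟩, hi⟩
        exact (measure_mono this).trans (measure_iUnion_le _)
      exact h0.mapL Φ }

lemma toComplexMeasure_apply [IsFiniteMeasure μ] [Fact (1 ≤ p)] (hp : p ≠ ∞)
    (Φ : Lp ℂ p μ →L[ℂ] ℂ) {A : Set X} (hA : MeasurableSet A) :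
    toComplexMeasure hp Φ A = Φ (indicatorConstLp p hA (measure_ne_top μ A) 1) :=
  dif_pos hA

/-- Radon–Nikodym, applied separately to the real and imaginary parts of `toComplexMeasure`.
Absolute continuity holds since the indicator of a null set is zero in `L^p`. -/
lemma exists_integrable_density [IsFiniteMeasure μ] [Fact (1 ≤ p)] (hp : p ≠ ∞)
    (Φ : Lp ℂ p μ →L[ℂ] ℂ) :
    ∃ g : X → ℂ, Measurable g ∧ Integrable g μ ∧ ∀ {A : Set X} (hA : MeasurableSet A),
      Φ (indicatorConstLp p hA (measure_ne_top μ A) 1) = ∫ x in A, g x ∂μ := by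
  set c := toComplexMeasure hp Φ with hc
  have habs : ∀ A : Set X, μ.toENNRealVectorMeasure A = 0 → c A = 0 := by
    intro A h
    by_cases hA : MeasurableSet A
    · rw [Measure.toENNRealVectorMeasure_apply_measurable hA] at h
      rw [hc, toComplexMeasure_apply hp Φ hA]
      have : indicatorConstLp p hA (measure_ne_top μ A) (1 : ℂ) = 0 := by
        rw [← norm_eq_zero, norm_indicatorConstLp (zero_lt_one.trans_le Fact.out).ne' hp]
        have h0 : μ.real A = 0 := by simp [measureReal_def, h]
        rw [h0, Real.zero_rpow, mul_zero]
        have : 0 < p.toReal := ENNReal.toReal_pos (zero_lt_one.trans_le Fact.out).ne' hp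
        positivity
      rw [this, map_zero]
    · exact c.not_measurable hA
  have hre := SignedMeasure.withDensityᵥ_rnDeriv_eq (ComplexMeasure.re c) μ
    (fun A h => show (c A).re = 0 by rw [habs A h]; rfl)
  have him := SignedMeasure.withDensityᵥ_rnDeriv_eq (ComplexMeasure.im c) μ
    (fun A h => show (c A).im = 0 by rw [habs A h]; rfl)
  set a := (ComplexMeasure.re c).rnDeriv μ
  set b := (ComplexMeasure.im c).rnDeriv μ
  have ha : Integrable a μ := SignedMeasure.integrable_rnDeriv _ _
  have hb : Integrable b μ := SignedMeasure.integrable_rnDeriv _ _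
  have ham : Measurable a := SignedMeasure.measurable_rnDeriv _ _
  have hbm : Measurable b := SignedMeasure.measurable_rnDeriv _ _
  refine ⟨fun x => (a x : ℂ) + (b x : ℂ) * Complex.I, by fun_prop,
    ha.ofReal.add (hb.ofReal.mul_const _), fun {A} hA => ?_⟩
  have hai : Integrable (fun x => (a x : ℂ)) (μ.restrict A) := ha.ofReal.restrict
  have hbi : Integrable (fun x => (b x : ℂ) * Complex.I) (μ.restrict A) :=
    (hb.ofReal.mul_const _).restrict
  simp only []
  rw [← toComplexMeasure_apply hp Φ hA, ← hc, integral_add hai hbi, integral_mul_const, integral_complex_ofReal,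
    integral_complex_ofReal, ← withDensityᵥ_apply ha hA, ← withDensityᵥ_apply hb hA, hre, him]
  exact (Complex.re_add_im (c A)).symm

/-- Once `g ∈ L^q`, Hölder makes the integral continuous in `f`. Two continuous functionals that
agree on indicators agree on simple functions, which are dense for `p < ∞`. -/
lemma eq_integral_of_indicator [IsFiniteMeasure μ] [Fact (1 ≤ p)] (hp : p ≠ ∞)
    (hpq : p.HolderConjugate q) (Φ : Lp ℂ p μ →L[ℂ] ℂ) {g : X → ℂ} (hg : MemLp g q μ)
    (h : ∀ {A : Set X} (hA : MeasurableSet A),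
      Φ (indicatorConstLp p hA (measure_ne_top μ A) 1) = ∫ x in A, g x ∂μ) (f : Lp ℂ p μ) :
    Φ f = ∫ x, f x * g x ∂μ := by
  have : Fact (1 ≤ q) := ⟨hpq.symm.one_le⟩
  set Ψ : Lp ℂ p μ →L[ℂ] ℂ :=
    ((ContinuousLinearMap.mul ℂ ℂ).lpPairing μ p q).flip (hg.toLp g) with hΨ
  have hΨ' (f : Lp ℂ p μ) : Ψ f = ∫ x, f x * g x ∂μ := by
    rw [hΨ, ContinuousLinearMap.flip_apply, ContinuousLinearMap.lpPairing_eq_integral]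
    refine integral_congr_ae ?_
    filter_upwards [hg.coeFn_toLp] with x hx
    simp [hx]
  rw [← hΨ']
  induction f using Lp.induction hp with
  | indicatorConst c hs hμs =>
    rename_i s
    have h1 : (Lp.simpleFunc.indicatorConst p hs hμs.ne c : Lp ℂ p μ)
        = c • indicatorConstLp p hs (measure_ne_top μ s) (1 : ℂ) := by
      rw [Lp.simpleFunc.coe_indicatorConst]
      ext1
      filter_upwards [indicatorConstLp_coeFn (p := p) (hs := hs) (hμs := hμs.ne) (c := c),
        Lp.coeFn_smul c (indicatorConstLp p hs (measure_ne_top μ s) (1 : ℂ)),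
        indicatorConstLp_coeFn (p := p) (hs := hs) (hμs := hμs.ne) (c := (1 : ℂ))] with x h1 h2 h3
      rw [h1, h2, Pi.smul_apply, h3]
      by_cases hx : x ∈ s <;> simp [hx]
    rw [h1, map_smul, map_smul, h hs, hΨ']
    congr 1
    rw [← integral_indicator hs]
    refine integral_congr_ae ?_
    filter_upwards [indicatorConstLp_coeFn (p := p) (hs := hs) (hμs := hμs.ne) (c := (1 : ℂ))]
      with x h3
    rw [h3]
    by_cases hx : x ∈ s <;> simp [hx]
  | add hf hg _ h1 h2 => rw [map_add, map_add, h1, h2]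
  | isClosed => exact isClosed_eq Φ.continuous Ψ.continuous

/-- Converse of Hölder, by testing on extremal functions. For `q = ∞` this is the conjugate phase of
`g` on `{|g| > C}`. For `q < ∞` it is `conj g · |g|^{q-2}`, which gives `‖g‖_q^q ≤ C ‖g‖_q^{q-1}`;
division is legitimate because `g` is already known to lie in `L^q`. -/
lemma eLpNorm_le_of_integral_le [IsFiniteMeasure μ] [Fact (1 ≤ p)] (hp : p ≠ ∞)
    (hpq : p.HolderConjugate q) {g : X → ℂ} (hgm : Measurable g) (hg : MemLp g q μ) {C : ℝ}
    (hC : 0 ≤ C)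
    (h : ∀ f : X → ℂ, MemLp f p μ → ‖∫ x, f x * g x ∂μ‖ ≤ C * (eLpNorm f p μ).toReal) :
    eLpNorm g q μ ≤ ENNReal.ofReal C := by
  rcases eq_or_ne q ∞ with rfl | hq
  · have hp1 : p = 1 := by
      simpa using hpq.inv_add_inv_eq_one
    subst hp1
    rw [eLpNorm_exponent_top]
    refine eLpNormEssSup_le_of_ae_bound ?_
    set A : Set X := {x | C < ‖g x‖}
    have hA : MeasurableSet A := measurableSet_lt measurable_const hgm.norm
    set f : X → ℂ := A.indicator fun x => (starRingEnd ℂ) (g x) * ((‖g x‖⁻¹ : ℝ) : ℂ) with hf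
    have hfm : Measurable f := by
      refine Measurable.indicator ?_ hA
      have := Complex.continuous_conj.measurable.comp hgm
      exact this.mul (Complex.measurable_ofReal.comp hgm.norm.inv)
    have hfn (x : X) : ‖f x‖ = A.indicator (fun _ => (1 : ℝ)) x := by
      by_cases hx : x ∈ A
      · have : ‖g x‖ ≠ 0 := (hC.trans_lt hx).ne'
        simp [hf, hx, this]
      · simp [hf, hx]
    have hfg (x : X) : f x * g x = ((A.indicator (fun x => ‖g x‖) x : ℝ) : ℂ) := by
      by_cases hx : x ∈ A
      · have : (‖g x‖ : ℂ) ≠ 0 := by exact_mod_cast (hC.trans_lt hx).ne'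
        simp only [hf, hx, indicator_of_mem, Complex.ofReal_inv]
        rw [mul_right_comm, mul_comm _ (g x), Complex.mul_conj, Complex.normSq_eq_norm_sq]
        push_cast
        field_simp
      · simp [hf, hx]
    have hf1 : MemLp f 1 μ := by
      refine MemLp.of_bound hfm.aestronglyMeasurable 1 (ae_of_all _ fun x => ?_)
      rw [hfn]
      exact indicator_le' (fun _ _ => le_rfl) (fun _ _ => zero_le_one) x
    have hgi : Integrable g μ := memLp_one_iff_integrable.1 (hg.mono_exponent le_top)
    have h1 := h f hf1
    have hfnorm : (eLpNorm f 1 μ).toReal = ∫ x in A, (1 : ℝ) ∂μ := by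
      have := (memLp_one_iff_integrable.1 hf1).norm
      rw [eLpNorm_one_eq_lintegral_enorm, ← integral_norm_eq_lintegral_enorm hfm.aestronglyMeasurable]
      simp_rw [hfn]
      rw [integral_indicator hA]
    simp_rw [hfg] at h1
    rw [integral_complex_ofReal, hfnorm, integral_indicator hA, Complex.norm_real,
      Real.norm_of_nonneg (by positivity), ← integral_const_mul] at h1
    -- The integrand is strictly positive on `A`, so a nonpositive integral forces `A` to be null.
    have h2 : ∫ x in A, (‖g x‖ - C * 1) ∂μ ≤ 0 := by
      rw [integral_sub hgi.norm.integrableOn (by simp)]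
      linarith
    have hnn : 0 ≤ᵐ[μ.restrict A] fun x => ‖g x‖ - C * 1 := by
      filter_upwards [ae_restrict_mem hA] with x hx
      have : C < ‖g x‖ := hx
      simp only [Pi.zero_apply]
      linarith
    have h3 := (setIntegral_eq_zero_iff_of_nonneg_ae hnn
      (hgi.norm.integrableOn.sub (by simp))).1 (le_antisymm h2 (integral_nonneg_of_ae hnn))
    rw [Filter.EventuallyEq, ae_restrict_iff' hA] at h3
    filter_upwards [h3] with x hx
    by_contra! hlt
    have := hx hlt
    simp only [Pi.zero_apply] at this
    linarith
  · have hr : p.toReal.HolderConjugate q.toReal := by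
      have hq1 : 1 < q.toReal := by
        have h1 : q ≠ 1 := by
          rintro rfl
          exact hp (by simpa using hpq.inv_add_inv_eq_one)
        have := (ENNReal.toReal_lt_toReal ENNReal.one_ne_top hq).2
          (lt_of_le_of_ne hpq.symm.one_le h1.symm)
        simpa using this
      exact (hpq.symm.toReal hq1).symm
    have hq1 : 1 < q.toReal := hr.symm.lt
    set r := q.toReal
    have hq0 : q ≠ 0 := by rintro rfl; simp [r] at hq1; linarith
    set f : X → ℂ := fun x => (starRingEnd ℂ) (g x) * ((‖g x‖ ^ (r - 2) : ℝ) : ℂ) with hf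
    have hfm : Measurable f := by
      have := Complex.continuous_conj.measurable.comp hgm
      exact this.mul (Complex.measurable_ofReal.comp (hgm.norm.pow_const _))
    have hfn (x : X) : ‖f x‖ = ‖g x‖ ^ (r - 1) := by
      rcases eq_or_ne (g x) 0 with hx | hx
      · simp [hf, hx, Real.zero_rpow (by linarith : r - 1 ≠ 0)]
      · have : 0 < ‖g x‖ := norm_pos_iff.2 hx
        simp only [hf, norm_mul, RCLike.norm_conj, Complex.norm_real]
        rw [Real.norm_of_nonneg (by positivity), ← Real.rpow_one_add' this.le (by linarith)]
        ring_nf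
    have hfg (x : X) : f x * g x = ((‖g x‖ ^ r : ℝ) : ℂ) := by
      rcases eq_or_ne (g x) 0 with hx | hx
      · simp [hf, hx, Real.zero_rpow (by linarith : r ≠ 0)]
      · have : 0 < ‖g x‖ := norm_pos_iff.2 hx
        simp only [hf]
        rw [mul_right_comm, mul_comm _ (g x), Complex.mul_conj, Complex.normSq_eq_norm_sq,
          ← Complex.ofReal_mul, ← Real.rpow_natCast, ← Real.rpow_add this]
        norm_num
    have hfe : eLpNorm f p μ = eLpNorm g q μ ^ (r - 1) := by
      rw [← eLpNorm_norm f]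
      simp_rw [hfn]
      rw [eLpNorm_norm_rpow _ (by linarith)]
      congr 2
      rw [← ENNReal.ofReal_toReal hp, ← ENNReal.ofReal_mul ENNReal.toReal_nonneg,
        ← ENNReal.ofReal_toReal hq]
      congr 1
      have := hr.symm.mul_eq_add
      simp only [r] at *
      linarith
    have hf1 : MemLp f p μ := ⟨hfm.aestronglyMeasurable, by
      rw [hfe]
      exact ENNReal.rpow_lt_top_of_nonneg (by linarith) hg.2.ne⟩
    have h1 := h f hf1
    simp_rw [hfg] at h1
    rw [integral_complex_ofReal, hfe, Complex.norm_real, Real.norm_of_nonneg (by positivity)] at h1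
    have hint : ∫ x, ‖g x‖ ^ r ∂μ = (eLpNorm g q μ).toReal ^ r := by
      have h2 := hg.eLpNorm_eq_integral_rpow_norm hq0 hq
      rw [h2, ENNReal.toReal_ofReal (by positivity), ← Real.rpow_mul (by positivity),
        inv_mul_cancel₀ (by positivity), Real.rpow_one]
    rw [hint, ← ENNReal.toReal_rpow] at h1
    rw [← ENNReal.ofReal_toReal hg.2.ne]
    refine ENNReal.ofReal_le_ofReal ?_
    have hM : 0 ≤ (eLpNorm g q μ).toReal := ENNReal.toReal_nonneg
    set M := (eLpNorm g q μ).toReal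
    rcases hM.eq_or_lt with h0 | h0
    · rw [← h0]; exact hC
    · have : M ^ r = M * M ^ (r - 1) := by
        rw [← Real.rpow_one_add' h0.le (by linarith)]
        ring_nf
      rw [this] at h1
      exact le_of_mul_le_mul_right h1 (by positivity)

/-- The dual of `L^p` of a finite measure, `1 ≤ p < ∞`. -/
theorem exists_memLp_of_strongDual [IsFiniteMeasure μ] [Fact (1 ≤ p)] (hp : p ≠ ∞)
    (hpq : p.HolderConjugate q) (Φ : Lp ℂ p μ →L[ℂ] ℂ) :
    ∃ g : X → ℂ, MemLp g q μ ∧ ∀ f : Lp ℂ p μ, Φ f = ∫ x, f x * g x ∂μ := by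
  obtain ⟨g, hgm, hgi, hg⟩ := exists_integrable_density hp Φ
  have hq1 : 1 ≤ q := hpq.symm.one_le
  -- So far `g` is only integrable. Its truncations are bounded, hence in `L^q`, so the converse of
  -- Hölder applies to them.
  set E : ℕ → Set X := fun k => {x | ‖g x‖ ≤ k}
  have hE (k : ℕ) : MeasurableSet (E k) := measurableSet_le hgm.norm measurable_const
  have hgk (k : ℕ) : MemLp ((E k).indicator g) q μ := by
    refine MemLp.of_bound (hgm.indicator (hE k)).aestronglyMeasurable k (ae_of_all _ fun x => ?_)
    by_cases hx : x ∈ E k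
    · rw [indicator_of_mem hx]
      exact hx
    · simp [hx]
  have hbound (k : ℕ) : eLpNorm ((E k).indicator g) q μ ≤ ENNReal.ofReal ‖Φ‖ := by
    -- Multiplication by the indicator of `E k` is a contraction, and `Φ ∘ R` has the truncated
    -- density. This bounds all truncations by the single constant `‖Φ‖`.
    set R : Lp ℂ p μ →L[ℂ] Lp ℂ p μ := LinearMap.mkContinuous
      { toFun := fun f => ((Lp.memLp f).indicator (hE k)).toLp _
        map_add' := fun f h => by
          rw [← MemLp.toLp_add]
          refine MemLp.toLp_congr _ _ ?_
          filter_upwards [Lp.coeFn_add f h] with x hx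
          by_cases hxE : x ∈ E k
          · simp only [Pi.add_apply, indicator_of_mem hxE, hx]
          · simp [hxE]
        map_smul' := fun c f => by
          rw [RingHom.id_apply, ← MemLp.toLp_const_smul]
          refine MemLp.toLp_congr _ _ ?_
          filter_upwards [Lp.coeFn_smul c f] with x hx
          by_cases hxE : x ∈ E k
          · simp only [Pi.smul_apply, indicator_of_mem hxE, hx]
          · simp [hxE] } 1 (fun f => by
        rw [one_mul, LinearMap.coe_mk, AddHom.coe_mk, Lp.norm_toLp, Lp.norm_def]
        exact ENNReal.toReal_mono (Lp.memLp f).2.ne (eLpNorm_indicator_le _)) with hR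
    have hR1 : ‖R‖ ≤ 1 := LinearMap.mkContinuous_norm_le _ zero_le_one _
    have hRΦ := eq_integral_of_indicator hp hpq (Φ ∘L R) (hgk k) (fun {A} hA => by
      have h1 : R (indicatorConstLp p hA (measure_ne_top μ A) 1)
          = indicatorConstLp p (hA.inter (hE k)) (measure_ne_top μ _) 1 := by
        change ((Lp.memLp (indicatorConstLp p hA (measure_ne_top μ A) (1 : ℂ))).indicator
          (hE k)).toLp _ = _
        refine MemLp.toLp_congr _ _ ?_
        filter_upwards [indicatorConstLp_coeFn (p := p) (hs := hA) (hμs := measure_ne_top μ A)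
          (c := (1 : ℂ))] with x hx
        by_cases hxE : x ∈ E k
        · by_cases hxA : x ∈ A <;> simp [hxE, hxA, hx]
        · simp [hxE]
      rw [ContinuousLinearMap.comp_apply, h1, hg (hA.inter (hE k)), setIntegral_indicator (hE k)])
    refine eLpNorm_le_of_integral_le hp hpq (hgm.indicator (hE k)) (hgk k) (norm_nonneg _)
      fun f hf => ?_
    have h1 : ∫ x, f x * (E k).indicator g x ∂μ = Φ (R (hf.toLp f)) := by
      rw [← ContinuousLinearMap.comp_apply, hRΦ]
      refine integral_congr_ae ?_
      filter_upwards [hf.coeFn_toLp] with x hx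
      rw [hx]
    rw [h1, ← Lp.norm_toLp f hf]
    calc ‖Φ (R (hf.toLp f))‖ ≤ ‖Φ‖ * (1 * ‖hf.toLp f‖) :=
          (Φ.le_opNorm _).trans (by gcongr; exact R.le_of_opNorm_le hR1 _)
      _ = _ := by rw [one_mul]
  have hgq : MemLp g q μ := by
    refine ⟨hgm.aestronglyMeasurable, lt_of_le_of_lt ?_ (ENNReal.ofReal_lt_top (r := ‖Φ‖))⟩
    -- Fatou: the truncations converge pointwise to `g` with uniformly bounded norms.
    refine (Lp.eLpNorm_lim_le_liminf_eLpNorm (fun k => (hgk k).1) g (ae_of_all _ fun x => ?_)).trans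
      (liminf_le_of_le (by isBoundedDefault) fun b hb => ?_)
    · refine tendsto_const_nhds.congr' ?_
      filter_upwards [eventually_ge_atTop ⌈‖g x‖⌉₊] with k hk
      have : x ∈ E k := Nat.ceil_le.1 hk
      simp [this]
    · obtain ⟨k, hk⟩ := hb.exists
      exact hk.trans (hbound k)
  exact ⟨g, hgq, eq_integral_of_indicator hp hpq Φ hgq hg⟩

/-- A linear functional on `V` that is bounded by the `L^p` seminorm pulled back along `j` is given
by integration against a function in the conjugate `L^q` space. -/
theorem exists_memLp_of_le_eLpNorm_of_isFiniteMeasure [IsFiniteMeasure μ] [Fact (1 ≤ p)]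
    (hp : p ≠ ∞) (hpq : p.HolderConjugate q) {V : Type*} [AddCommGroup V] [Module ℂ V]
    (j : V →ₗ[ℂ] X → ℂ) (hj : ∀ v, MemLp (j v) p μ) (F : V →ₗ[ℂ] ℂ) (C : ℝ)
    (hF : ∀ v, ‖F v‖ ≤ C * (eLpNorm (j v) p μ).toReal) :
    ∃ g : X → ℂ, MemLp g q μ ∧ ∀ v, F v = ∫ x, j v x * g x ∂μ := by
  let J : V →ₗ[ℂ] Lp ℂ p μ :=
    { toFun := fun v => (hj v).toLp
      map_add' := fun v w => by
        rw [← MemLp.toLp_add]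
        exact MemLp.toLp_congr _ _ (by rw [map_add])
      map_smul' := fun c v => by
        rw [RingHom.id_apply, ← MemLp.toLp_const_smul]
        exact MemLp.toLp_congr _ _ (by rw [map_smul]) }
  have hJ (v : V) : ‖J v‖ = (eLpNorm (j v) p μ).toReal := Lp.norm_toLp _ (hj v)
  -- A merely algebraic section suffices: `hF` forces `F` to vanish on the kernel of `J`, so `F ∘ s`
  -- does not depend on the choice and inherits the bound `C`. Hahn–Banach then extends it to all of
  -- `L^p`.
  obtain ⟨s, hs⟩ := J.rangeRestrict.exists_rightInverse_of_surjective J.range_rangeRestrict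
  have hs' (y : LinearMap.range J) : J (s y) = y :=
    congrArg Subtype.val (LinearMap.congr_fun hs y)
  let G : StrongDual ℂ (LinearMap.range J) := (F ∘ₗ s).mkContinuous C fun y => by
    have := hF (s y)
    rw [← hJ, hs' y] at this
    exact this
  obtain ⟨Φ, hΦ, -⟩ := exists_extension_norm_eq (LinearMap.range J) G
  obtain ⟨g, hg, hΦg⟩ := exists_memLp_of_strongDual hp hpq Φ
  refine ⟨g, hg, fun v => ?_⟩
  have h1 : F v = Φ (J v) := by
    have h2 := hΦ (J.rangeRestrict v)
    change Φ (J v) = _ at h2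
    rw [h2]
    change F v = F (s (J.rangeRestrict v))
    rw [← sub_eq_zero, ← map_sub, ← norm_le_zero_iff]
    refine (hF _).trans (le_of_eq ?_)
    rw [← hJ, map_sub, hs']
    change C * ‖J v - J v‖ = 0
    rw [sub_self, norm_zero, mul_zero]
  rw [h1, hΦg]
  refine integral_congr_ae ?_
  filter_upwards [(hj v).coeFn_toLp] with x hx
  rw [← hx]
  rfl

/-- Multiplication by `w^{1/p}` absorbs the density. For `p = ∞` the exponent `1 / p.toReal` is `0`,
and only the null sets matter; they are the same because `w > 0`. -/
lemma eLpNorm_withDensity_eq (hp : p ≠ 0) {w : X → ℝ≥0} (hw : Measurable w)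
    (hw0 : ∀ x, 0 < w x) (f : X → ℂ) :
    eLpNorm f p (μ.withDensity fun x => (w x : ℝ≥0∞)) =
      eLpNorm (fun x => (((w x : ℝ) ^ (1 / p.toReal) : ℝ) : ℂ) * f x) p μ := by
  have hwm : Measurable fun x => (w x : ℝ≥0∞) := by fun_prop
  rcases eq_or_ne p ∞ with rfl | hp'
  · have h1 : (μ.withDensity fun x => (w x : ℝ≥0∞)) ≪ μ := withDensity_absolutelyContinuous _ _
    have h2 : μ ≪ (μ.withDensity fun x => (w x : ℝ≥0∞)) :=
      withDensity_absolutelyContinuous' hwm.aemeasurable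
        (ae_of_all _ fun x => by simpa using (hw0 x).ne')
    simp only [eLpNorm_exponent_top, ENNReal.toReal_top, div_zero, Real.rpow_zero,
      Complex.ofReal_one, one_mul]
    exact le_antisymm (eLpNormEssSup_mono_measure _ h1) (eLpNormEssSup_mono_measure _ h2)
  · have hpr : 0 < p.toReal := ENNReal.toReal_pos hp hp'
    rw [eLpNorm_eq_lintegral_rpow_enorm_toReal hp hp', eLpNorm_eq_lintegral_rpow_enorm_toReal hp hp',
      lintegral_withDensity_eq_lintegral_mul_non_measurable _ hwm
        (ae_of_all _ fun x => ENNReal.coe_lt_top)]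
    congr 2
    ext x
    rw [Pi.mul_apply, enorm_mul, ENNReal.mul_rpow_of_nonneg _ _ hpr.le]
    congr 1
    have h3 : ‖(((w x : ℝ) ^ (1 / p.toReal) : ℝ) : ℂ)‖ₑ = (w x : ℝ≥0∞) ^ (1 / p.toReal) := by
      rw [← ofReal_norm, Complex.norm_real, Real.norm_of_nonneg (by positivity),
        ← ENNReal.ofReal_rpow_of_pos (by exact_mod_cast hw0 x), ENNReal.ofReal_coe_nnreal]
    rw [h3, ← ENNReal.rpow_mul, one_div_mul_cancel hpr.ne', ENNReal.rpow_one]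

/-- The `σ`-finite version of `exists_memLp_of_le_eLpNorm_of_isFiniteMeasure`. -/
theorem exists_memLp_of_le_eLpNorm [SigmaFinite μ] [Fact (1 ≤ p)]
    (hp : p ≠ ∞) (hpq : p.HolderConjugate q) {V : Type*} [AddCommGroup V] [Module ℂ V]
    (j : V →ₗ[ℂ] X → ℂ) (hj : ∀ v, MemLp (j v) p μ) (F : V →ₗ[ℂ] ℂ) (C : ℝ)
    (hF : ∀ v, ‖F v‖ ≤ C * (eLpNorm (j v) p μ).toReal) :
    ∃ g : X → ℂ, MemLp g q μ ∧ ∀ v, F v = ∫ x, j v x * g x ∂μ := by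
  have hp0 : p ≠ 0 := (zero_lt_one.trans_le Fact.out).ne'
  have hq0 : q ≠ 0 := (zero_lt_one.trans_le hpq.symm.one_le).ne'
  -- A positive integrable density replaces `μ` by a finite measure with the same null sets;
  -- rescaling `j` by `w^{-1/p}` preserves its norms.
  obtain ⟨w, hw0, hw, hwi⟩ := exists_pos_lintegral_lt_of_sigmaFinite μ one_ne_zero
  have hwR (x : X) : (0 : ℝ) < w x := by exact_mod_cast hw0 x
  have hsum : 1 / p.toReal + 1 / q.toReal = 1 := by
    have := congrArg ENNReal.toReal hpq.inv_add_inv_eq_one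
    rw [ENNReal.toReal_add (ENNReal.inv_ne_top.2 hp0) (ENNReal.inv_ne_top.2 hq0)] at this
    simpa using this
  set ν := μ.withDensity fun x => (w x : ℝ≥0∞) with hν
  have : IsFiniteMeasure ν := isFiniteMeasure_withDensity (hwi.trans ENNReal.one_lt_top).ne
  have hac : ν ≪ μ := withDensity_absolutelyContinuous _ _
  have hcoe (a : ℝ) : Measurable fun x => (((w x : ℝ) ^ a : ℝ) : ℂ) := by fun_prop
  let k : V →ₗ[ℂ] X → ℂ :=
    { toFun := fun v x => (((w x : ℝ) ^ (-(1 / p.toReal)) : ℝ) : ℂ) * j v x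
      map_add' := fun v v' => by ext x; simp [mul_add]
      map_smul' := fun c v => by ext x; simp [mul_left_comm] }
  have hk (v : V) (x : X) : k v x = (((w x : ℝ) ^ (-(1 / p.toReal)) : ℝ) : ℂ) * j v x := rfl
  have hkj (v : V) : eLpNorm (k v) p ν = eLpNorm (j v) p μ := by
    rw [hν, eLpNorm_withDensity_eq hp0 hw hw0]
    congr 1
    ext x
    rw [hk, ← mul_assoc, ← Complex.ofReal_mul, ← Real.rpow_add (hwR x)]
    simp
  obtain ⟨g, hg, hFg⟩ := exists_memLp_of_le_eLpNorm_of_isFiniteMeasure (μ := ν) hp hpq k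
    (fun v => ⟨(hcoe _).aestronglyMeasurable.mul ((hj v).1.mono_ac hac),
      by rw [hkj]; exact (hj v).2⟩) F C (fun v => by rw [hkj]; exact hF v)
  have hac' : μ ≪ ν := withDensity_absolutelyContinuous' (by fun_prop)
    (ae_of_all _ fun x => by simpa using (hw0 x).ne')
  refine ⟨fun x => (((w x : ℝ) ^ (1 / q.toReal) : ℝ) : ℂ) * g x,
    ⟨(hcoe _).aestronglyMeasurable.mul (hg.1.mono_ac hac'), ?_⟩, fun v => ?_⟩
  · rw [← eLpNorm_withDensity_eq hq0 hw hw0]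
    exact hg.2
  · rw [hFg v, hν, integral_withDensity_eq_integral_smul hw]
    congr 1
    ext x
    rw [hk, NNReal.smul_def, Complex.real_smul]
    have h2 : (w x : ℝ) ^ (1 / q.toReal) = (w x : ℝ) * (w x : ℝ) ^ (-(1 / p.toReal)) := by
      rw [show 1 / q.toReal = 1 + -(1 / p.toReal) by linarith, Real.rpow_add (hwR x),
        Real.rpow_one]
    simp only [h2]
    push_cast
    ring

end LpDual

namespace BeurlingUltra

/-! ### The Young conjugate -/

/-- Multiplication by `m > 0` is left adjoint to division by `m`, and `EReal.exp` is an order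
isomorphism, so both commute with the supremum. Infinite values of the conjugate need no separate
treatment. -/
lemma expYoung_eq_iSup (ω : WeightFunction) {m : ℕ} (hm : 1 ≤ m) {N : ℕ} (α : MultiIndex N) :
    ω.expYoung m α = ⨆ t : ℝ≥0, ENNReal.ofReal
      (Real.exp (α.len * t - m * (ω.toFun (Real.exp t).toNNReal : ℝ))) := by
  have hm0 : (0 : EReal) < (m : EReal) := by exact_mod_cast hm
  have hmt : (m : EReal) ≠ ⊤ := EReal.natCast_ne_top m
  have hmR : (m : ℝ) ≠ 0 := by exact_mod_cast (by omega : m ≠ 0)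
  have hgc : GaloisConnection (fun a : EReal => (m : EReal) * a) (fun c => c / (m : EReal)) := by
    intro a c
    rw [EReal.le_div_iff_mul_le hm0 hmt, mul_comm]
  unfold WeightFunction.expYoung WeightFunction.youngConj
  rw [hgc.l_iSup, ← EReal.expOrderIso_apply, OrderIso.map_iSup]
  refine iSup_congr fun t => ?_
  rw [EReal.expOrderIso_apply, ← EReal.exp_coe]
  congr 1
  rw [← EReal.coe_natCast, ← EReal.coe_mul]
  congr 1
  field_simp

/-- Since `e ≤ 4`, two applications of the doubling property suffice. -/
lemma exists_dilation_bound (ω : WeightFunction) : ∃ L : ℕ, 1 ≤ L ∧ ∀ t : ℝ,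
    (ω.toFun (Real.exp (t + 1)).toNNReal : ℝ) ≤ L * (1 + ω.toFun (Real.exp t).toNNReal) := by
  obtain ⟨K, hK1, hK⟩ := ω.doubling'
  obtain ⟨L, hL⟩ := exists_nat_ge (K + K * K)
  have hL1 : (1 : ℝ≥0) ≤ L := (hK1.trans le_self_add).trans hL
  refine ⟨L, by exact_mod_cast hL1, fun t => ?_⟩
  have h1 : (Real.exp (t + 1)).toNNReal ≤ 2 * (2 * (Real.exp t).toNNReal) := by
    rw [← NNReal.coe_le_coe]
    push_cast
    rw [Real.coe_toNNReal _ (Real.exp_pos _).le, Real.coe_toNNReal _ (Real.exp_pos _).le,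
      Real.exp_add]
    have := Real.exp_one_lt_d9
    have := Real.exp_pos t
    nlinarith
  set s := (Real.exp t).toNNReal
  have h2 : ω.toFun (Real.exp (t + 1)).toNNReal ≤ L * (1 + ω.toFun s) :=
    calc ω.toFun (Real.exp (t + 1)).toNNReal ≤ ω.toFun (2 * (2 * s)) := ω.monotone' h1
      _ ≤ K * (1 + K * (1 + ω.toFun s)) := (hK _).trans (by gcongr; exact hK s)
      _ ≤ K * (1 + ω.toFun s + K * (1 + ω.toFun s)) := by gcongr; exact le_self_add
      _ = (K + K * K) * (1 + ω.toFun s) := by ring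
      _ ≤ L * (1 + ω.toFun s) := by gcongr
  exact_mod_cast h2

/-- The constant `exp (-1)` in `[0, ∞]`. -/
def expNegOne : ℝ≥0∞ := ENNReal.ofReal (Real.exp (-1))

lemma expNegOne_lt_one : expNegOne < 1 := by
  rw [expNegOne, ENNReal.ofReal_lt_one, Real.exp_lt_one_iff]
  norm_num

/-- With `k = mL`, the dilation bound gives `|α| t - k ω(e^t) ≤ k - |α| + (|α| (t+1) - m
ω(e^{t+1}))`. Shifting `t` to `t + 1` in the supremum therefore gains `e^{-|α|}` at the cost of the
constant `e^k`. The second inequality is the reciprocal of the first. -/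
lemma exists_expYoung_le (ω : WeightFunction) {m : ℕ} (hm : 1 ≤ m) :
    ∃ k : ℕ, 1 ≤ k ∧ ∃ C : ℝ≥0, ∀ (N : ℕ) (α : MultiIndex N),
      ω.expYoung k α ≤ C * expNegOne ^ α.len * ω.expYoung m α ∧
      (ω.expYoung m α)⁻¹ ≤ C * expNegOne ^ α.len * (ω.expYoung k α)⁻¹ := by
  obtain ⟨L, hL1, hL⟩ := exists_dilation_bound ω
  have hk : 1 ≤ m * L := Nat.mul_pos hm hL1
  have hpow (N : ℕ) (α : MultiIndex N) :
      expNegOne ^ α.len = ENNReal.ofReal (Real.exp (-(α.len : ℝ))) := by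
    rw [expNegOne, ← ENNReal.ofReal_pow (Real.exp_pos _).le, ← Real.exp_nat_mul]
    simp
  have h1 (N : ℕ) (α : MultiIndex N) : ω.expYoung (m * L) α ≤
      ENNReal.ofReal (Real.exp (m * L)) * expNegOne ^ α.len * ω.expYoung m α := by
    rw [expYoung_eq_iSup ω hk, expYoung_eq_iSup ω hm, ENNReal.mul_iSup]
    refine iSup_le fun t => le_trans ?_ (le_iSup _ (t + 1))
    rw [hpow, ← ENNReal.ofReal_mul (Real.exp_pos _).le, ← Real.exp_add,
      ← ENNReal.ofReal_mul (Real.exp_pos _).le, ← Real.exp_add]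
    refine ENNReal.ofReal_le_ofReal (Real.exp_le_exp.2 ?_)
    have := mul_le_mul_of_nonneg_left (hL t) (Nat.cast_nonneg (α := ℝ) m)
    push_cast
    linarith
  refine ⟨m * L, hk, (Real.exp (m * L)).toNNReal, fun N α => ⟨h1 N α, ?_⟩⟩
  change _ ≤ ENNReal.ofReal (Real.exp (m * L)) * _ * _
  have h2 := ENNReal.inv_le_inv.2 (h1 N α)
  set c := ENNReal.ofReal (Real.exp (m * L)) * expNegOne ^ α.len with hc
  have hc0 : c ≠ 0 := by
    rw [hc, hpow, ← ENNReal.ofReal_mul (Real.exp_pos _).le, ENNReal.ofReal_ne_zero_iff]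
    positivity
  have hct : c ≠ ∞ := by
    rw [hc, hpow]
    finiteness
  rw [ENNReal.mul_inv (Or.inl hc0) (Or.inl hct)] at h2
  calc (ω.expYoung m α)⁻¹ = c * (c⁻¹ * (ω.expYoung m α)⁻¹) := by
        rw [← mul_assoc, ENNReal.mul_inv_cancel hc0 hct, one_mul]
    _ ≤ _ := by gcongr

/-- The sum factors into `N` geometric series, one per coordinate. -/
lemma tsum_pow_len (x : ℝ≥0∞) (N : ℕ) :
    ∑' α : MultiIndex N, x ^ α.len = ((1 - x)⁻¹) ^ N := by
  induction N with
  | zero => simp [MultiIndex.len, tsum_fintype]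
  | succ N ih =>
    have h (α : ℕ × (Fin N → ℕ)) : x ^ MultiIndex.len (N := N + 1) (Fin.cons α.1 α.2) =
        x ^ α.1 * x ^ MultiIndex.len α.2 := by
      rw [MultiIndex.len, Fin.sum_univ_succ, pow_add]
      rfl
    rw [← (Fin.consEquiv fun _ => ℕ).tsum_eq]
    change ∑' α : ℕ × (Fin N → ℕ), x ^ MultiIndex.len (N := N + 1) (Fin.cons α.1 α.2) = _
    simp_rw [h]
    rw [ENNReal.tsum_prod (f := fun a b => x ^ a * x ^ MultiIndex.len b)]
    simp_rw [ENNReal.tsum_mul_left, ENNReal.tsum_mul_right]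
    rw [ENNReal.tsum_geometric, pow_succ, mul_comm]
    congr 1

lemma tsum_expNegOne_pow_lt_top (N : ℕ) : ∑' α : MultiIndex N, expNegOne ^ α.len < ∞ := by
  rw [tsum_pow_len]
  refine ENNReal.pow_lt_top (ENNReal.inv_lt_top.2 ?_)
  exact tsub_pos_of_lt expNegOne_lt_one

lemma ellNorm_expNegOne_pow_lt_top (N : ℕ) {p : ℝ≥0∞} (hp : 1 ≤ p) (hp' : p ≠ ∞) :
    ellNorm p (fun α : MultiIndex N => expNegOne ^ α.len) < ∞ := by
  have h1 : 1 ≤ p.toReal := by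
    simpa using (ENNReal.toReal_le_toReal ENNReal.one_ne_top hp').2 hp
  unfold ellNorm
  rw [if_neg hp']
  refine ENNReal.rpow_lt_top_of_nonneg (by positivity) (ne_of_lt ?_)
  refine lt_of_le_of_lt (ENNReal.tsum_le_tsum fun α => ?_) (tsum_expNegOne_pow_lt_top N)
  have h2 : expNegOne ^ α.len ≤ 1 := pow_le_one₀ zero_le expNegOne_lt_one.le
  simpa using ENNReal.rpow_le_rpow_of_exponent_ge h2 h1

/-! ### The embedding of the test functions -/

lemma tsupport_pderiv_subset {N : ℕ} (i : Fin N) (f : Smooth N) :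
    tsupport (pderiv i f).1 ⊆ tsupport f.1 :=
  (closure_mono fun x hx => by
    rw [Function.mem_support] at hx ⊢
    intro h
    exact hx (by
      change fderiv ℝ f.1 x _ = 0
      rw [h, zero_apply])).trans (tsupport_fderiv_subset ℝ (f := f.1))

lemma tsupport_mderiv_subset {N : ℕ} (α : MultiIndex N) (f : Smooth N) :
    tsupport (mderiv α f).1 ⊆ tsupport f.1 := by
  have h (l : List (Module.End ℂ (Smooth N)))
      (hl : ∀ D ∈ l, ∀ f : Smooth N, tsupport (D f).1 ⊆ tsupport f.1) :
      tsupport (l.prod f).1 ⊆ tsupport f.1 := by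
    induction l with
    | nil => simp
    | cons D l ih =>
      rw [List.prod_cons, Module.End.mul_apply]
      exact (hl D (by simp) _).trans (ih fun D' hD' => hl D' (by simp [hD']))
  refine h _ fun D hD => ?_
  obtain ⟨i, rfl⟩ := List.mem_ofFn.1 hD
  intro f
  induction α i with
  | zero => simp
  | succ n ih =>
    rw [pow_succ', Module.End.mul_apply]
    exact (tsupport_pderiv_subset i _).trans ih

/-- `‖exp(nω) 1_K‖_p`. -/
def indicatorWNorm (ω : WeightFunction) {N : ℕ} (n : ℤ) (p : ℝ≥0∞) (K : Set (Eucl N)) : ℝ≥0∞ :=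
  wNorm ω n p (K.indicator fun _ => 1)

lemma indicatorWNorm_lt_top (ω : WeightFunction) {N : ℕ} (n : ℤ) (p : ℝ≥0∞)
    {K : Set (Eucl N)} (hK : IsCompact K) : indicatorWNorm ω n p K < ∞ := by
  obtain ⟨C, hC⟩ := hK.exists_bound_of_continuousOn (continuous_expWeight ω n).continuousOn
  refine lt_of_le_of_lt (eLpNorm_mono (g := K.indicator fun _ => C) fun x => ?_)
    (memLp_indicator_const p hK.measurableSet C (Or.inr hK.measure_lt_top.ne)).2
  by_cases hx : x ∈ K
  · simp only [hx, indicator_of_mem, mul_one]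
    exact (hC x hx).trans (le_abs_self _)
  · simp [hx]

/-- On `K` the weighted derivative is pointwise at most the seminorm, and off `K` it vanishes.
Finiteness of the seminorm allows it to be moved under the `L^p` norm as a scalar. -/
lemma wNorm_mderiv_le (ω : WeightFunction) {N : ℕ} (n : ℤ) (p : ℝ≥0∞) {K : Set (Eucl N)}
    {k : ℕ} {φ : Smooth N} (hφ : tsupport φ.1 ⊆ K) (hfin : pSeminorm ω K k φ < ∞)
    (α : MultiIndex N) :
    wNorm ω n p (mderiv α φ).1 * (ω.expYoung k α)⁻¹ ≤ indicatorWNorm ω n p K * pSeminorm ω K k φ := by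
  set c := ((ω.expYoung k α)⁻¹).toReal
  set d := (pSeminorm ω K k φ).toReal
  have hc' : ‖(c : ℂ)‖ₑ = (ω.expYoung k α)⁻¹ := by
    rw [← ofReal_norm, Complex.norm_real, Real.norm_of_nonneg ENNReal.toReal_nonneg,
      ENNReal.ofReal_toReal (inv_expYoung_ne_top ω α)]
  have hd' : ‖(d : ℂ)‖ₑ = pSeminorm ω K k φ := by
    rw [← ofReal_norm, Complex.norm_real, Real.norm_of_nonneg ENNReal.toReal_nonneg,
      ENNReal.ofReal_toReal hfin.ne]
  rw [mul_comm, mul_comm (indicatorWNorm ω n p K), indicatorWNorm, wNorm, wNorm, ← hc', ← hd',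
    ← eLpNorm_const_smul, ← eLpNorm_const_smul]
  refine eLpNorm_mono_enorm fun x => ?_
  simp only [Pi.smul_apply, smul_eq_mul, enorm_mul, hc', hd']
  by_cases hx : x ∈ K
  · have h1 : ‖(mderiv α φ).1 x‖ₑ * (ω.expYoung k α)⁻¹ ≤ pSeminorm ω K k φ :=
      (le_iSup (fun α => ‖(mderiv α φ).1 x‖ₑ * (ω.expYoung k α)⁻¹) α).trans
        (le_iSup₂ (f := fun x (_ : x ∈ K) =>
          ⨆ α : MultiIndex N, ‖(mderiv α φ).1 x‖ₑ * (ω.expYoung k α)⁻¹) x hx)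
    simp only [hx, indicator_of_mem, enorm_one, mul_one]
    rw [mul_left_comm, mul_comm (ω.expYoung k α)⁻¹, mul_comm (pSeminorm ω K k φ)]
    gcongr
  · have : (mderiv α φ).1 x = 0 :=
      image_eq_zero_of_notMem_tsupport fun h => hx (hφ (tsupport_mderiv_subset α φ h))
    simp [this]

/-- The seminorm at level `k` controls each derivative uniformly in `α`; the factor `e^{-|α|}`
gained in passing from `k` to `m` makes the `ℓ^p` sum over `α` converge. -/
lemma exists_rNorm_le (ω : WeightFunction) (N : ℕ) {m : ℕ} (hm : 1 ≤ m) (n : ℤ) {p : ℝ≥0∞}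
    (hp : 1 ≤ p) (hp' : p ≠ ∞) {K : Set (Eucl N)} (hK : IsCompact K) :
    ∃ k : ℕ, 1 ≤ k ∧ ∃ C : ℝ≥0, ∀ φ : TestFun ω N, tsupport (TestFun.toSmooth φ).1 ⊆ K →
      rNorm ω m n p φ.toSmooth ≤ C * pSeminorm ω K k φ.toSmooth := by
  obtain ⟨k, hk, C, hC⟩ := exists_expYoung_le ω hm
  have hI := indicatorWNorm_lt_top ω (-n) p hK
  have hE := ellNorm_expNegOne_pow_lt_top N hp hp'
  refine ⟨k, hk, (C * indicatorWNorm ω (-n) p K *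
    ellNorm p (fun α : MultiIndex N => expNegOne ^ α.len)).toNNReal, fun φ hφ => ?_⟩
  have hfin : pSeminorm ω K k φ.toSmooth < ∞ := φ.2.2 K hK k hk
  rw [ENNReal.coe_toNNReal (by finiteness)]
  calc rNorm ω m n p φ.toSmooth
      ≤ ellNorm p (fun α : MultiIndex N =>
          (C * indicatorWNorm ω (-n) p K * pSeminorm ω K k φ.toSmooth) * expNegOne ^ α.len) := by
        refine ellNorm_mono fun α => ?_
        calc wNorm ω (-n) p (mderiv α φ.toSmooth).1 * (ω.expYoung m α)⁻¹
            ≤ wNorm ω (-n) p (mderiv α φ.toSmooth).1 *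
              (C * expNegOne ^ α.len * (ω.expYoung k α)⁻¹) := by gcongr; exact (hC N α).2
          _ = C * expNegOne ^ α.len *
              (wNorm ω (-n) p (mderiv α φ.toSmooth).1 * (ω.expYoung k α)⁻¹) := by ring
          _ ≤ C * expNegOne ^ α.len *
              (indicatorWNorm ω (-n) p K * pSeminorm ω K k φ.toSmooth) := by
              exact mul_le_mul' le_rfl (wNorm_mderiv_le ω (-n) p hφ hfin α)
          _ = _ := by ring
    _ = _ := by
        rw [ellNorm_const_mul hp]
        ring

/-- The embedding of `𝒟_ω(ℝ^N)` into `𝒪^m_{n,ω,p}(ℝ^N)`. -/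
lemma exists_embedding (ω : WeightFunction) (N : ℕ) {m : ℕ} (hm : 1 ≤ m) (n : ℤ) {p : ℝ≥0∞}
    [hp : Fact (1 ≤ p)] (hp' : p ≠ ∞) :
    ∃ ι : TestFun ω N →L[ℂ] OSpace ω N m n p, ∀ φ, (ι φ).toSmooth = φ.toSmooth := by
  let ι : TestFun ω N →ₗ[ℂ] OSpace ω N m n p :=
    { toFun := fun φ => ⟨φ.toSmooth, by
        have hK : IsCompact (tsupport (TestFun.toSmooth φ).1) := φ.2.1
        obtain ⟨k, hk, C, hC⟩ := exists_rNorm_le ω N hm n hp.out hp' hK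
        exact (hC φ subset_rfl).trans_lt
          (ENNReal.mul_lt_top ENNReal.coe_lt_top (φ.2.2 _ hK k hk))⟩
      map_add' := fun _ _ => rfl
      map_smul' := fun _ _ => rfl }
  have hι (φ : TestFun ω N) : (ι φ).toSmooth = φ.toSmooth := rfl
  -- The pulled-back norm is itself one of the seminorms generating the inductive limit topology, so
  -- it alone witnesses continuity.
  let q : TestFun.ContSeminorm ω N := ⟨(normSeminorm ℂ (OSpace ω N m n p)).comp ι, fun K hK => by
    obtain ⟨k, hk, C, hC⟩ := exists_rNorm_le ω N hm n hp.out hp' hK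
    refine ⟨k, hk, C, fun φ hφ => le_trans ?_ (hC φ hφ)⟩
    exact ENNReal.ofReal_toReal_le⟩
  refine ⟨⟨ι, (TestFun.withSeminorms ω N).continuous_normedSpace_rng _ ι ⟨{q}, 1, ?_⟩⟩, hι⟩
  rw [one_smul, Finset.sup_singleton]
  exact le_rfl

/-! ### Hölder's inequality -/

/-- Hölder for counting measure; the endpoint pair `{1, ∞}` is treated by hand. -/
lemma tsum_mul_le_ellNorm_mul_ellNorm {ι : Type*} {p q : ℝ≥0∞} (hpq : p.HolderConjugate q)
    (a b : ι → ℝ≥0∞) : ∑' i, a i * b i ≤ ellNorm p a * ellNorm q b := by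
  have key {p q : ℝ≥0∞} (hpq : p.HolderConjugate q) (hp : p = ∞) (a b : ι → ℝ≥0∞) :
      ∑' i, a i * b i ≤ ellNorm p a * ellNorm q b := by
    subst hp
    have hq : q = 1 := by simpa using hpq.inv_add_inv_eq_one
    subst hq
    simp only [ellNorm, if_true, ENNReal.one_ne_top, if_false, ENNReal.toReal_one,
      ENNReal.rpow_one, div_one]
    rw [← ENNReal.tsum_mul_left]
    exact ENNReal.tsum_le_tsum fun i => by gcongr; exact le_iSup a i
  rcases eq_or_ne p ∞ with hp | hp
  · exact key hpq hp a b
  rcases eq_or_ne q ∞ with hq | hq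
  · have := key hpq.symm hq b a
    simpa only [mul_comm] using this
  have hp1 : 1 < p.toReal := by
    have h1 : p ≠ 1 := by
      rintro rfl
      exact hq (by simpa using hpq.inv_add_inv_eq_one)
    have := (ENNReal.toReal_lt_toReal ENNReal.one_ne_top hp).2
      (lt_of_le_of_ne hpq.one_le h1.symm)
    simpa using this
  let _ : MeasurableSpace ι := ⊤
  have := ENNReal.lintegral_mul_le_Lp_mul_Lq (Measure.count : Measure ι) (hpq.toReal hp1)
    (f := a) (g := b) measurable_from_top.aemeasurable measurable_from_top.aemeasurable
  simpa only [lintegral_count, Pi.mul_apply, ellNorm, hp, hq, if_false] using this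

lemma lintegral_enorm_mul_le (ω : WeightFunction) {N : ℕ} (n : ℤ) {p q : ℝ≥0∞}
    (hpq : p.HolderConjugate q) {f g : Eucl N → ℂ} (hf : AEStronglyMeasurable f volume)
    (hg : AEStronglyMeasurable g volume) :
    ∫⁻ x, ‖f x * g x‖ₑ ≤ wNorm ω n q f * wNorm ω (-n) p g := by
  have hc (k : ℤ) := (continuous_expWeight ω (N := N) k).aestronglyMeasurable (μ := volume)
  have hqp : q.HolderConjugate p := hpq.symm
  have h := eLpNorm_smul_le_mul_eLpNorm (p := q) (q := p) (r := 1) ((hc (-n)).mul hg) ((hc n).mul hf)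
  refine le_trans (le_of_eq ?_) h
  rw [eLpNorm_one_eq_lintegral_enorm]
  congr 1
  ext x
  congr 1
  have h1 : (Real.exp (n * ω.radial x) : ℂ) * (Real.exp ((-n : ℤ) * ω.radial x) : ℂ) = 1 := by
    rw [← Complex.ofReal_mul, ← Real.exp_add]
    simp
  calc f x * g x = ((Real.exp (n * ω.radial x) : ℂ) * (Real.exp ((-n : ℤ) * ω.radial x) : ℂ))
        * (f x * g x) := by rw [h1, one_mul]
    _ = _ := by
      simp only [Pi.smul_apply', Pi.mul_apply, smul_eq_mul]
      ring

variable {ω : WeightFunction} {N m : ℕ} {n : ℤ} {p q : ℝ≥0∞}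

/-- Inserting `expYoung` and its inverse is harmless when it is finite. When it is infinite the two
do not cancel, but `hfin` then forces `f` to have norm zero, so the left side vanishes. -/
lemma lintegral_enorm_mul_mderiv_le (hpq : p.HolderConjugate q) (α : MultiIndex N)
    {f : Eucl N → ℂ} (hf : AEStronglyMeasurable f volume)
    (hfin : wNorm ω n q f * ω.expYoung m α ≠ ∞) (g : Smooth N) :
    ∫⁻ x, ‖f x * (mderiv α g).1 x‖ₑ ≤
      (wNorm ω n q f * ω.expYoung m α) *
        (wNorm ω (-n) p (mderiv α g).1 * (ω.expYoung m α)⁻¹) := by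
  refine (lintegral_enorm_mul_le ω n hpq hf
    (Smooth.contDiff _).continuous.aestronglyMeasurable).trans ?_
  rcases eq_or_ne (ω.expYoung m α) ∞ with h | h
  · have : wNorm ω n q f = 0 := by
      by_contra h0
      exact hfin (by rw [h, ENNReal.mul_top h0])
    simp [this]
  · refine le_of_eq ?_
    calc wNorm ω n q f * wNorm ω (-n) p (mderiv α g).1
        = (wNorm ω n q f * wNorm ω (-n) p (mderiv α g).1) *
          (ω.expYoung m α * (ω.expYoung m α)⁻¹) := by
            rw [ENNReal.mul_inv_cancel (expYoung_ne_zero ω α) h, mul_one]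
      _ = _ := by ring

lemma enorm_derivPairing_le (hpq : p.HolderConjugate q) (α : MultiIndex N)
    {f : Eucl N → ℂ} (hf : AEStronglyMeasurable f volume)
    (hfin : wNorm ω n q f * ω.expYoung m α ≠ ∞) (g : Smooth N) :
    ‖derivPairing α f g‖ₑ ≤ (wNorm ω n q f * ω.expYoung m α) *
        (wNorm ω (-n) p (mderiv α g).1 * (ω.expYoung m α)⁻¹) := by
  refine le_trans ?_ (lintegral_enorm_mul_mderiv_le hpq α hf hfin g)
  rw [derivPairing, enorm_mul, enorm_pow, enorm_neg, enorm_one, one_pow, one_mul]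
  exact enorm_integral_le_lintegral_enorm _

section OSpace

variable [hp : Fact (1 ≤ p)]

lemma wNorm_mderiv_mul_le_rNorm (g : Smooth N) (α : MultiIndex N) :
    wNorm ω (-n) p (mderiv α g).1 * (ω.expYoung m α)⁻¹ ≤ rNorm ω m n p g :=
  le_ellNorm hp.out (fun α : MultiIndex N => wNorm ω (-n) p (mderiv α g).1 * (ω.expYoung m α)⁻¹) α

lemma integrable_mul_mderiv (hpq : p.HolderConjugate q) (α : MultiIndex N)
    {f : Eucl N → ℂ} (hf : AEStronglyMeasurable f volume)
    (hfin : wNorm ω n q f * ω.expYoung m α ≠ ∞) (g : OSpace ω N m n p) :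
    Integrable (fun x => f x * (mderiv α g.toSmooth).1 x) volume :=
  ⟨hf.mul (Smooth.contDiff _).continuous.aestronglyMeasurable,
    (lintegral_enorm_mul_mderiv_le (p := p) hpq α hf hfin g.toSmooth).trans_lt
      (ENNReal.mul_lt_top hfin.lt_top
        ((wNorm_mderiv_mul_le_rNorm g.toSmooth α).trans_lt g.rNorm_lt_top))⟩

/-- The explicit operator norm bound is what later allows summation in the norm of the dual. -/
lemma exists_strongDual_derivPairing (hpq : p.HolderConjugate q) (α : MultiIndex N)
    {f : Eucl N → ℂ} (hf : AEStronglyMeasurable f volume)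
    (hfin : wNorm ω n q f * ω.expYoung m α ≠ ∞) :
    ∃ V : StrongDual ℂ (OSpace ω N m n p), (∀ g, V g = derivPairing α f g.toSmooth) ∧
      ‖V‖ ≤ (wNorm ω n q f * ω.expYoung m α).toReal := by
  let V : OSpace ω N m n p →ₗ[ℂ] ℂ :=
    { toFun := fun g => derivPairing α f g.toSmooth
      map_add' := fun g h => by
        rw [derivPairing, derivPairing, derivPairing, ← mul_add,
          ← integral_add (integrable_mul_mderiv hpq α hf hfin g)
            (integrable_mul_mderiv hpq α hf hfin h)]
        simp only [map_add]
        congr 2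
        ext x
        exact mul_add _ _ _
      map_smul' := fun c g => by
        rw [derivPairing, derivPairing, RingHom.id_apply, smul_eq_mul, mul_left_comm]
        simp only [map_smul]
        rw [← integral_const_mul c]
        exact congrArg _ (integral_congr_ae (ae_of_all _ fun x =>
          mul_left_comm (f x) c ((mderiv α g.toSmooth).1 x))) }
  have hV (g : OSpace ω N m n p) :
      ‖V g‖ ≤ (wNorm ω n q f * ω.expYoung m α).toReal * ‖g‖ := by
    rw [OSpace.norm_def, ← ENNReal.toReal_mul, ← toReal_enorm]
    refine ENNReal.toReal_mono (ENNReal.mul_ne_top hfin g.rNorm_lt_top.ne) ?_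
    exact (enorm_derivPairing_le (p := p) hpq α hf hfin g.toSmooth).trans
      (mul_le_mul' le_rfl (wNorm_mderiv_mul_le_rNorm g.toSmooth α))
  exact ⟨V.mkContinuous _ hV, fun g => rfl, V.mkContinuous_norm_le ENNReal.toReal_nonneg hV⟩

lemma MemWeightedSum.ne_top (hq : 1 ≤ q) {f : MultiIndex N → Eucl N → ℂ}
    (hf : MemWeightedSum ω m n q f) (α : MultiIndex N) :
    wNorm ω n q (f α) * ω.expYoung m α ≠ ∞ :=
  ((le_ellNorm hq (fun α => wNorm ω n q (f α) * ω.expYoung m α) α).trans_lt hf.2).ne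

/-- A family in the weighted sum space defines a continuous linear functional. -/
lemma exists_strongDual_of_memWeightedSum (hpq : p.HolderConjugate q)
    {f : MultiIndex N → Eucl N → ℂ} (hf : MemWeightedSum ω m n q f) :
    ∃ F : StrongDual ℂ (OSpace ω N m n p),
      ∀ g, HasSum (fun α => derivPairing α (f α) g.toSmooth) (F g) := by
  have hfin := hf.ne_top hpq.symm.one_le
  choose V hV _ using fun α => exists_strongDual_derivPairing (p := p) hpq α (hf.1 α) (hfin α)
  have hle (g : OSpace ω N m n p) : ∑' α, ‖V α g‖ₑ ≤
      ellNorm q (fun α => wNorm ω n q (f α) * ω.expYoung m α) * rNorm ω m n p g.toSmooth := by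
    refine le_trans (ENNReal.tsum_le_tsum fun α => ?_)
      (tsum_mul_le_ellNorm_mul_ellNorm hpq.symm _ _)
    rw [hV]
    exact enorm_derivPairing_le hpq α (hf.1 α) (hfin α) g.toSmooth
  have hlt (g : OSpace ω N m n p) :
      ellNorm q (fun α => wNorm ω n q (f α) * ω.expYoung m α) * rNorm ω m n p g.toSmooth ≠ ∞ :=
    ENNReal.mul_ne_top hf.2.ne g.rNorm_lt_top.ne
  have hsn (g : OSpace ω N m n p) : Summable fun α => ‖V α g‖ := by
    have := ENNReal.summable_toReal ((hle g).trans_lt (hlt g).lt_top).ne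
    simpa only [toReal_enorm] using this
  have hs (g : OSpace ω N m n p) : Summable fun α => V α g := (hsn g).of_norm
  let F : OSpace ω N m n p →ₗ[ℂ] ℂ :=
    { toFun := fun g => ∑' α, V α g
      map_add' := fun g h => by
        simp only [map_add]
        exact (hs g).tsum_add (hs h)
      map_smul' := fun c g => by
        simp only [map_smul]
        exact (hs g).tsum_const_smul c }
  refine ⟨F.mkContinuous (ellNorm q (fun α => wNorm ω n q (f α) * ω.expYoung m α)).toReal
    fun g => ?_, fun g => ?_⟩
  · rw [OSpace.norm_def, ← ENNReal.toReal_mul]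
    refine (norm_tsum_le_tsum_norm (hsn g)).trans ?_
    simp only [← toReal_enorm]
    rw [← ENNReal.tsum_toReal_eq fun α => enorm_ne_top]
    exact ENNReal.toReal_mono (hlt g) (hle g)
  · have := (hs g).hasSum
    simp only [hV] at this ⊢
    convert this using 1
    exact tsum_congr fun α => hV α g

/-! ### Convergence in the space of ultradistributions -/

lemma IsSumOfDerivs.hasSum_apply {T : UltraDist ω N} {f : MultiIndex N → Eucl N → ℂ}
    (h : IsSumOfDerivs T f) (φ : TestFun ω N) :
    HasSum (fun α => derivPairing α (f α) φ.toSmooth) (T φ) := by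
  obtain ⟨U, hU, hT⟩ := h
  let ev : UltraDist ω N →+ ℂ := ⟨⟨fun S => S φ, rfl⟩, fun _ _ => rfl⟩
  have := hT.map ev (continuous_eval_const φ)
  simp only [← hU]
  exact this

/-- Pointwise convergence implies convergence in the strong topology. -/
lemma isSumOfDerivs_of_hasSum (hm : 1 ≤ m) (hp' : p ≠ ∞) (hpq : p.HolderConjugate q)
    {T : UltraDist ω N} {f : MultiIndex N → Eucl N → ℂ} (hf : MemWeightedSum ω m n q f)
    (hT : ∀ φ : TestFun ω N, HasSum (fun α => derivPairing α (f α) φ.toSmooth) (T φ)) :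
    IsSumOfDerivs T f := by
  -- At level `m` the terms are only `ℓ^q` in `α`, which need not give norm convergence. At level
  -- `k` the factor `e^{-|α|}` makes their norms summable, so the functionals are taken on the space
  -- of level `k`.
  obtain ⟨k, hk, C, hC⟩ := exists_expYoung_le ω hm
  obtain ⟨ι, hι⟩ := exists_embedding ω N hk n (p := p) hp'
  set A := ellNorm q (fun α => wNorm ω n q (f α) * ω.expYoung m α) with hA
  have hle (α : MultiIndex N) :
      wNorm ω n q (f α) * ω.expYoung k α ≤ C * A * expNegOne ^ α.len :=
    calc wNorm ω n q (f α) * ω.expYoung k α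
        ≤ wNorm ω n q (f α) * (C * expNegOne ^ α.len * ω.expYoung m α) := by
          gcongr
          exact (hC N α).1
      _ = C * (wNorm ω n q (f α) * ω.expYoung m α) * expNegOne ^ α.len := by ring
      _ ≤ _ := by
          gcongr
          exact le_ellNorm hpq.symm.one_le (fun α => wNorm ω n q (f α) * ω.expYoung m α) α
  have hsum : ∑' α : MultiIndex N, wNorm ω n q (f α) * ω.expYoung k α ≠ ∞ := by
    refine ne_top_of_le_ne_top ?_ (ENNReal.tsum_le_tsum hle)
    rw [ENNReal.tsum_mul_left]
    exact ENNReal.mul_ne_top (ENNReal.mul_ne_top ENNReal.coe_ne_top hf.2.ne)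
      (tsum_expNegOne_pow_lt_top N).ne
  choose V hV hVn using fun α => exists_strongDual_derivPairing (p := p) (m := k) hpq α (hf.1 α)
    (ENNReal.ne_top_of_tsum_ne_top hsum α)
  have hVs : Summable V :=
    Summable.of_norm_bounded (ENNReal.summable_toReal hsum) hVn
  -- Composition with the embedding is continuous from the normed dual to the strong dual, so it
  -- carries the norm convergence over. The limit is then identified with `T` pointwise.
  have hW := hVs.hasSum.mapL (ContinuousLinearMap.precomp ℂ ι)
  refine ⟨fun α => (V α).comp ι, fun α φ => ?_, ?_⟩
  · rw [ContinuousLinearMap.comp_apply, hV, hι]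
  · have hTW : T = ContinuousLinearMap.precomp ℂ ι (∑' α, V α) := by
      ext φ
      have h1 := hVs.hasSum.mapL (ContinuousLinearMap.apply ℂ ℂ (ι φ))
      simp only [ContinuousLinearMap.apply_apply, hV, hι] at h1
      exact (hT φ).unique h1
    rw [hTW]
    exact hW

/-! ### The representation of the dual -/

variable (N) in
/-- The product of the counting measure on multi-indices and Lebesgue measure on `ℝ^N`. -/
abbrev indexedVolume : Measure (MultiIndex N × Eucl N) := Measure.count.prod volume

lemma eLpNorm_indexedVolume_eq (hq : q ≠ 0) (hq' : q ≠ ∞) {G : MultiIndex N × Eucl N → ℂ}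
    (hG : AEStronglyMeasurable G (indexedVolume N)) :
    ellNorm q (fun α => eLpNorm (fun x => G (α, x)) q volume) = eLpNorm G q (indexedVolume N) := by
  have hqr : 0 < q.toReal := ENNReal.toReal_pos hq hq'
  rw [eLpNorm_eq_lintegral_rpow_enorm_toReal hq hq', lintegral_prod _ (hG.enorm.pow_const _),
    lintegral_count, ellNorm, if_neg hq']
  congr 1
  refine tsum_congr fun α => ?_
  rw [eLpNorm_eq_lintegral_rpow_enorm_toReal hq hq', ← ENNReal.rpow_mul,
    one_div_mul_cancel hqr.ne', ENNReal.rpow_one]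

/-- For finite `q` this is Tonelli. For `q = ∞` an almost everywhere bound on the product holds on
every slice, because each index has positive counting mass. -/
lemma ellNorm_eLpNorm_le (hq : q ≠ 0) {G : MultiIndex N × Eucl N → ℂ}
    (hG : AEStronglyMeasurable G (indexedVolume N)) :
    ellNorm q (fun α => eLpNorm (fun x => G (α, x)) q volume) ≤ eLpNorm G q (indexedVolume N) := by
  rcases eq_or_ne q ∞ with rfl | hq'
  · simp only [ellNorm, if_true, eLpNorm_exponent_top]
    refine iSup_le fun α => ?_
    have h := Measure.ae_ae_of_ae_prod (enorm_ae_le_eLpNormEssSup G (indexedVolume N))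
    exact essSup_le_of_ae_le _ (Measure.ae_count_iff.1 h α)
  · exact (eLpNorm_indexedVolume_eq hq hq' hG).le

/-- The family `(exp(-m φ*(|α|/m)) exp(-nω) ∂^α g)_α` as a function on `ℕ₀^N × ℝ^N`. -/
def weightedJet : OSpace ω N m n p →ₗ[ℂ] MultiIndex N × Eucl N → ℂ where
  toFun g z := ((ω.expYoung m z.1)⁻¹.toReal : ℂ) *
    ((Real.exp ((-n : ℤ) * ω.radial z.2) : ℂ) * (mderiv z.1 g.toSmooth).1 z.2)
  map_add' g h := by
    ext z
    simp only [map_add, Pi.add_apply]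
    rw [← mul_add, ← mul_add]
    rfl
  map_smul' c g := by
    ext z
    simp only [map_smul, Pi.smul_apply, RingHom.id_apply, smul_eq_mul]
    rw [mul_left_comm c, mul_left_comm c]
    rfl

lemma enorm_toReal_inv_expYoung (α : MultiIndex N) :
    ‖((ω.expYoung m α)⁻¹.toReal : ℂ)‖ₑ = (ω.expYoung m α)⁻¹ := by
  rw [← ofReal_norm, Complex.norm_real, Real.norm_of_nonneg ENNReal.toReal_nonneg,
    ENNReal.ofReal_toReal (inv_expYoung_ne_top ω α)]

lemma measurable_weightedJet (g : OSpace ω N m n p) : Measurable (weightedJet g) := by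
  refine measurable_from_prod_countable_right fun α => ?_
  have h : Continuous fun x : Eucl N => ((ω.expYoung m α)⁻¹.toReal : ℂ) *
      ((Real.exp ((-n : ℤ) * ω.radial x) : ℂ) * (mderiv α g.toSmooth).1 x) :=
    continuous_const.mul ((continuous_expWeight ω (-n)).mul
      (Smooth.contDiff (mderiv α g.toSmooth)).continuous)
  exact h.measurable

lemma eLpNorm_weightedJet (hp' : p ≠ ∞) (g : OSpace ω N m n p) :
    eLpNorm (weightedJet g) p (indexedVolume N) = rNorm ω m n p g.toSmooth := by
  rw [← eLpNorm_indexedVolume_eq (zero_lt_one.trans_le hp.out).ne' hp'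
    (measurable_weightedJet g).aestronglyMeasurable, rNorm]
  congr 1
  ext α
  rw [mul_comm, ← enorm_toReal_inv_expYoung, wNorm, ← eLpNorm_const_smul]
  rfl

/-- Every continuous linear functional is represented by a family in the weighted sum space. -/
lemma exists_memWeightedSum_of_continuous (hp' : p ≠ ∞) (hpq : p.HolderConjugate q)
    (F : StrongDual ℂ (OSpace ω N m n p)) :
    ∃ f : MultiIndex N → Eucl N → ℂ, MemWeightedSum ω m n q f ∧
      ∀ g, HasSum (fun α => derivPairing α (f α) g.toSmooth) (F g) := by
  have hq0 : q ≠ 0 := (zero_lt_one.trans_le hpq.symm.one_le).ne'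
  have hj (g : OSpace ω N m n p) : MemLp (weightedJet g) p (indexedVolume N) :=
    ⟨(measurable_weightedJet g).aestronglyMeasurable, by
      rw [eLpNorm_weightedJet hp']
      exact g.rNorm_lt_top⟩
  obtain ⟨G, hG, hFG⟩ := LpDual.exists_memLp_of_le_eLpNorm hp' hpq
    (weightedJet (ω := ω) (N := N) (m := m) (n := n) (p := p)) hj F ‖F‖ fun g => by
      rw [eLpNorm_weightedJet hp', ← OSpace.norm_def]
      exact F.le_opNorm g
  have hGα (α : MultiIndex N) : AEStronglyMeasurable (fun x => G (α, x)) volume :=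
    Measure.ae_count_iff.1 hG.1.prodMk_left α
  -- The transpose of the jet map applied to `G`; the sign cancels the one in `derivPairing`. Where
  -- `expYoung` is infinite, `f α` is zero.
  set f : MultiIndex N → Eucl N → ℂ := fun α x => (-1) ^ α.len *
    (((ω.expYoung m α)⁻¹.toReal : ℂ) * ((Real.exp ((-n : ℤ) * ω.radial x) : ℂ) * G (α, x))) with hf
  refine ⟨f, ⟨fun α => ?_, ?_⟩, fun g => ?_⟩
  · exact (((continuous_expWeight ω (-n)).aestronglyMeasurable.mul (hGα α)).const_mul _).const_mul _
  · refine lt_of_le_of_lt (ellNorm_mono fun α => ?_) ((ellNorm_eLpNorm_le hq0 hG.1).trans_lt hG.2)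
    have h1 : wNorm ω n q (f α) = (ω.expYoung m α)⁻¹ * eLpNorm (fun x => G (α, x)) q volume := by
      rw [← enorm_toReal_inv_expYoung, ← eLpNorm_const_smul, wNorm]
      refine eLpNorm_congr_enorm_ae (ae_of_all _ fun x => ?_)
      have h2 : (Real.exp (n * ω.radial x) : ℂ) * (Real.exp ((-n : ℤ) * ω.radial x) : ℂ) = 1 := by
        rw [← Complex.ofReal_mul, ← Real.exp_add]
        simp
      have h3 : (Real.exp (n * ω.radial x) : ℂ) * f α x = (-1) ^ α.len *
          (((Real.exp (n * ω.radial x) : ℂ) * (Real.exp ((-n : ℤ) * ω.radial x) : ℂ)) *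
          (((ω.expYoung m α)⁻¹.toReal : ℂ) * G (α, x))) := by
        simp only [hf]
        ring
      rw [h3, h2, one_mul, enorm_mul, enorm_pow, enorm_neg, enorm_one, one_pow, one_mul]
      rfl
    -- Only an inequality is available: the product of `expYoung` with its inverse is `0` when
    -- `expYoung` is infinite.
    rw [h1, mul_right_comm]
    exact (mul_le_mul' (ENNReal.inv_mul_le_one _) le_rfl).trans (one_mul _).le
  · have : p.HolderTriple q 1 := hpq
    have hint : Integrable (fun z => weightedJet g z * G z) (indexedVolume N) :=
      (hj g).integrable_mul hG
    have hpair (α : MultiIndex N) : derivPairing α (f α) g.toSmooth =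
        ∫ x, weightedJet g (α, x) * G (α, x) := by
      rw [derivPairing, ← integral_const_mul]
      refine integral_congr_ae (ae_of_all _ fun x => ?_)
      have h1 : ((-1 : ℂ) ^ α.len) * (-1) ^ α.len = 1 := by
        rw [← mul_pow]
        simp
      change (-1) ^ α.len * (f α x * (mderiv α g.toSmooth).1 x) =
        ((ω.expYoung m α)⁻¹.toReal : ℂ) * ((Real.exp ((-n : ℤ) * ω.radial x) : ℂ) *
          (mderiv α g.toSmooth).1 x) * G (α, x)
      simp only [hf]
      linear_combination (((ω.expYoung m α)⁻¹.toReal : ℂ) *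
        ((Real.exp ((-n : ℤ) * ω.radial x) : ℂ) * G (α, x)) * (mderiv α g.toSmooth).1 x) * h1
    -- Fubini: integrability on the product gives both absolute convergence of the series over `α`
    -- and its value `F g`.
    have hint' := hint.integral_prod_left
    have hFg : F g = ∑' α, ∫ x, weightedJet g (α, x) * G (α, x) := by
      refine (hFG g).trans ?_
      rw [integral_prod _ hint, integral_countable hint']
      simp
    simp only [hpair, hFg]
    exact (integrable_count_iff.1 hint').of_norm.hasSum

end OSpace

end BeurlingUltra

end

/-! ### The structure theorem. -/

open BeurlingUltra in
theorem theorem3p12 (N : ℕ) (ω : WeightFunction) (m : ℕ) (hm : 1 ≤ m) (n : ℤ)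
    (p p' : ENNReal) [Fact (1 ≤ p)] (hp : p ≠ ⊤) (hpp' : p.HolderConjugate p')
    (T : UltraDist ω N) :
    (OSpace.MemDual m n p T ↔
      ∃ f : MultiIndex N → Eucl N → ℂ, MemWeightedSum ω m n p' f ∧ IsSumOfDerivs T f) ∧
    (∀ F : OSpace ω N m n p →ₗ[ℂ] ℂ, OSpace.Extends F T →
      (Continuous F ↔
        ∃ f : MultiIndex N → Eucl N → ℂ, MemWeightedSum ω m n p' f ∧ IsSumOfDerivs T f ∧
          ∀ g : OSpace ω N m n p,
            HasSum (fun α => derivPairing α (f α) g.toSmooth) (F g))) := by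
  obtain ⟨ι, hι⟩ := exists_embedding ω N hm n (p := p) hp
  have key (F : StrongDual ℂ (OSpace ω N m n p))
      (hF : OSpace.Extends (F : OSpace ω N m n p →ₗ[ℂ] ℂ) T) :
      ∃ f : MultiIndex N → Eucl N → ℂ, MemWeightedSum ω m n p' f ∧ IsSumOfDerivs T f ∧
        ∀ g : OSpace ω N m n p, HasSum (fun α => derivPairing α (f α) g.toSmooth) (F g) := by
    obtain ⟨f, hf, hFf⟩ := exists_memWeightedSum_of_continuous hp hpp' F
    refine ⟨f, hf, isSumOfDerivs_of_hasSum hm hp hpp' hf fun φ => ?_, hFf⟩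
    obtain ⟨g, hg, hFg⟩ := hF φ
    rw [← hFg, ← hg]
    exact hFf g
  refine ⟨⟨?_, ?_⟩, fun F hF => ⟨fun hc => key ⟨F, hc⟩ hF, ?_⟩⟩
  · rintro ⟨F, hF⟩
    obtain ⟨f, hf, hT, -⟩ := key F hF
    exact ⟨f, hf, hT⟩
  · rintro ⟨f, hf, hT⟩
    obtain ⟨F, hF⟩ := exists_strongDual_of_memWeightedSum hpp' hf
    refine ⟨F, fun φ => ⟨ι φ, hι φ, (hF (ι φ)).unique ?_⟩⟩
    rw [hι]
    exact hT.hasSum_apply φ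
  · rintro ⟨f, hf, -, hFf⟩
    obtain ⟨F', hF'⟩ := exists_strongDual_of_memWeightedSum hpp' hf
    -- Uniqueness of sums identifies `F` with the functional that Hölder's inequality shows to be
    -- continuous.
    have : (F : OSpace ω N m n p → ℂ) = F' := funext fun g => (hFf g).unique (hF' g)
    rw [this]
    exact F'.continuous
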